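/- Let $\mathbf F=\mathbb C((t))\supset\mathbf O=\mathbb C[[t]]$. Let $V=\mathbb C^6$ have basis $v_1,\dots,v_6$ and the symplectic form with $\langle v_i,v_{7-i}\rangle=1=-\langle v_{7-i},v_i\rangle$ for $i=1,2,3$ and all other products zero. Let $\mathrm{PSp}(6)=\mathrm{GSp}(V)/\mathbb G_m$, let $\mathrm P\subset \mathrm{PSp}(6)$ be the stabilizer of $V_{12}=\langle v_1,v_2\rangle$, let $\mathrm U$ be its unipotent radical, and embed $\mathrm{PGL}(2)\hookrightarrow \mathrm{PSp}(6)$ diagonally into the Levi subgroup of $\mathrm P$: a matrix $a\in\mathrm{GL}(2)$ acts by $a$ on $V_{12}$ (basis $v_1,v_2$) and on $V_{34}$ (basis $v_3,v_4$), and by $dad$ with $d=\mathrm{diag}(1,-1)$ on $V_{56}$ (basis $v_5,v_6$). Put $H=\mathrm{PGL}(2)\ltimes\mathrm U$, embedded in $\overline G=\mathrm{PGL}(2)\times\mathrm{PSp}(6)$ by the identity of $\mathrm{PGL}(2)$ in the first factor and the above embedding in the second one. Let $\mathrm{Gr}_{\mathrm{PSp}(6)}=\mathrm{PSp}(6,\mathbf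 F)/\mathrm{PSp}(6,\mathbf O)$ and $\mathrm{Gr}_{\overline G}=\overline G(\mathbf F)/\overline G(\mathbf O)$ be the affine Grassmannians, with the Zariski topology of ind-schemes. Let $X$ be the lattice of all $\lambda=(\lambda_1,\lambda_2,\lambda_3,\lambda_4)\in(\tfrac12\mathbb Z)^4$ with $\lambda_1-\lambda_2,\ \lambda_2-\lambda_3\in\mathbb Z$ (coordinates with respect to the basis $\varepsilon_1,\varepsilon_2,\varepsilon_3,\delta$), and call $\lambda\in X$ relevant if $\lambda_1\ge\lambda_2$, $\lambda_3\ge0$ and $\lambda_4\ge0$. For relevant $\lambda$ let $\mathbb O^\lambda\subset\mathrm{Gr}_{\mathrm{PSp}(6)}$ be the $\mathrm{PGL}(2,\mathbf O)\ltimes\mathrm U(\mathbf F)$-orbit of the point $t^{\lambda_4}\,g\,t^{(\lambda_1,\lambda_2,\lambda_3)}$, where $g=\mathrm{Id}+E_{34}$, $t^{\lambda_4}$ is the image of the class of $\mathrm{diag}(t^{\lambda_4},t^{-\lambda_4})$ in $\mathrm{PGL}(2,\mathbf F)$, and $t^{(\lambda_1,\lambda_2,\lambda_3)}$ is the class of $\mathrm{diag}(t^{\lambda_1},t^{\lambda_2},t^{\lambda_3},t^{-\lambda_3},t^{-\lambda_2},t^{-\lambda_1})$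 in $\mathrm{PSp}(6,\mathbf F)$ (both classes are defined over $\mathbf F$). Let $\mathcal O^\lambda=H(\mathbf F)\cdot(\{1\}\times\mathbb O^\lambda)\subset\mathrm{Gr}_{\overline G}$ be the corresponding $H(\mathbf F)$-orbit. The simple roots of $\mathfrak f(4)$ are $$\alpha_1=\tfrac12(\varepsilon_1-\varepsilon_2-\varepsilon_3+\delta),\quad \alpha_2=\tfrac12(-\varepsilon_1+\varepsilon_2+\varepsilon_3+\delta),\quad \alpha_3=\tfrac12(\varepsilon_1-\varepsilon_2+\varepsilon_3-\delta),\quad \alpha_4=\varepsilon_2-\varepsilon_3.$$ **Proposition.** Let $\lambda,\lambda'$ be relevant. Then $\mathbb O^{\lambda'}$ lies in the closure of $\mathbb O^{\lambda}$ in $\mathrm{Gr}_{\mathrm{PSp}(6)}$ if and only if $\mathcal O^{\lambda'}$ lies in the closure of $\mathcal O^{\lambda}$ in $\mathrm{Gr}_{\overline G}$, and if this is so, then $\lambda-\lambda'=\sum_{i=1}^4a_i\alpha_i$ with $a_i\in\mathbb Z_{\ge0}$. -/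

import Mathlib

open scoped MatrixGroups

noncomputable section

namespace GaiottoF4

/-! ### Weights of `f(4)` -/

/-- The four simple roots `α₁, …, α₄` of `f(4)`, in the coordinates with respect to the basis
`ε₁, ε₂, ε₃, δ`. -/
def simpleRoot : Fin 4 → Fin 4 → ℚ :=
  ![![1 / 2, -1 / 2, -1 / 2, 1 / 2],
    ![-1 / 2, 1 / 2, 1 / 2, 1 / 2],
    ![1 / 2, -1 / 2, 1 / 2, -1 / 2],
    ![0, 1, -1, 0]]

/-- The weight lattice `X`: all coordinates lie in `½ℤ`, and `λ₁ - λ₂`, `λ₂ - λ₃` lie in `ℤ`. -/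
def weightLattice : Set (Fin 4 → ℚ) :=
  {l | (∀ i, ∃ n : ℤ, 2 * l i = n) ∧ (∃ n : ℤ, l 0 - l 1 = n) ∧ (∃ n : ℤ, l 1 - l 2 = n)}

/-- Relevant weights: `λ ∈ X` with `λ₁ - λ₂ ≥ 0`, `λ₃ ≥ 0` (that is, `(λ₁, λ₂, λ₃)` is a dominant
coweight of the Levi subgroup `L`) and `λ₄ ≥ 0`. -/
def IsRelevant (l : Fin 4 → ℚ) : Prop :=
  l ∈ weightLattice ∧ 0 ≤ l 0 - l 1 ∧ 0 ≤ l 2 ∧ 0 ≤ l 3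

/-! ### The groups `GSp(6)`, `PSp(6)`, `U`, and the embedding of `PGL(2)` -/

section Groups

variable {A B : Type*} [CommRing A] [CommRing B]

/-- The Gram matrix of the symplectic form: `⟨v_i, v_{7-i}⟩ = 1 = -⟨v_{7-i}, v_i⟩` for
`i = 1, 2, 3`, all other products being zero. The vector `v_i` has index `i - 1 : Fin 6`. -/
def gram (A : Type*) [CommRing A] : Matrix (Fin 6) (Fin 6) A :=
  Matrix.of fun i j => if i.val + j.val = 5 then (if i.val < 3 then 1 else -1) else 0

/-- The group of symplectic similitudes `GSp(6, A)`. -/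
def GSp6 (A : Type*) [CommRing A] : Subgroup (GL (Fin 6) A) where
  carrier := {M | ∃ c : Aˣ, M.val.transpose * gram A * M.val = c.val • gram A}
  one_mem' := ⟨1, by simp⟩
  mul_mem' := by
    rintro M N ⟨c, hc⟩ ⟨d, hd⟩
    refine ⟨c * d, ?_⟩
    have : (M * N).val.transpose * gram A * (M * N).val
        = N.val.transpose * (M.val.transpose * gram A * M.val) * N.val := by
      simp only [Units.val_mul, Matrix.transpose_mul, Matrix.mul_assoc]
    rw [this, hc, Matrix.mul_smul, Matrix.smul_mul, hd, smul_smul, Units.val_mul]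
  inv_mem' := by
    rintro M ⟨c, hc⟩
    refine ⟨c⁻¹, ?_⟩
    have h1 : M.val * (M⁻¹).val = 1 := by simp
    have h2 : (M⁻¹).val.transpose * M.val.transpose = 1 := by
      rw [← Matrix.transpose_mul, h1, Matrix.transpose_one]
    have h3 : (M⁻¹).val.transpose * (M.val.transpose * gram A * M.val) * (M⁻¹).val = gram A := by
      calc _ = ((M⁻¹).val.transpose * M.val.transpose) * gram A * (M.val * (M⁻¹).val) := by
            simp only [Matrix.mul_assoc]
        _ = gram A := by rw [h1, h2, Matrix.one_mul, Matrix.mul_one]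
    rw [hc, Matrix.mul_smul, Matrix.smul_mul] at h3
    rw [← h3, smul_smul, h3]
    simp

theorem scalar_mem_GSp6 (u : Aˣ) : Matrix.GeneralLinearGroup.scalar (Fin 6) u ∈ GSp6 A := by
  refine ⟨u * u, ?_⟩
  simp [← Matrix.smul_one_eq_diagonal, smul_smul]

/-- The scalar matrices in `GSp(6, A)`. -/
def GSp6.scalars (A : Type*) [CommRing A] : Subgroup (GSp6 A) :=
  (Matrix.GeneralLinearGroup.scalar (Fin 6) (R := A)).range.subgroupOf (GSp6 A)

instance GSp6.scalars_normal : (GSp6.scalars A).Normal where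
  conj_mem := by
    rintro ⟨n, hn⟩ ⟨u, rfl⟩ ⟨g, hg⟩
    refine ⟨u, ?_⟩
    have := Matrix.GeneralLinearGroup.scalar_commute u g
    simp [← this]

/-- `PSp(6, A) = GSp(6, A) / Aˣ`. For a ring with trivial Picard group, in particular for `𝐅` and
`𝐎`, these are exactly the `A`-points of the adjoint group `PSp(6)`. -/
def PSp6 (A : Type*) [CommRing A] : Type _ := GSp6 A ⧸ GSp6.scalars A

instance : Group (PSp6 A) := inferInstanceAs (Group (GSp6 A ⧸ GSp6.scalars A))

/-- The projection `GSp(6, A) → PSp(6, A)`. -/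
def PSp6.mk : GSp6 A →* PSp6 A := QuotientGroup.mk' (GSp6.scalars A)

theorem map_mem_GSp6 (f : A →+* B) {M : GL (Fin 6) A} (hM : M ∈ GSp6 A) :
    Matrix.GeneralLinearGroup.map f M ∈ GSp6 B := by
  obtain ⟨c, hc⟩ := hM
  refine ⟨Units.map f.toMonoidHom c, ?_⟩
  have hJ : (gram A).map f = gram B := by
    ext i j
    simp only [gram, Matrix.map_apply, Matrix.of_apply]
    split_ifs <;> simp
  have := congrArg (fun N => N.map f) hc
  simp only [Matrix.map_mul, hJ] at this
  refine Eq.trans this ?_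
  rw [← hJ]
  ext i j
  simp

/-- Functoriality of `GSp(6)` in the ring. -/
def GSp6.map (f : A →+* B) : GSp6 A →* GSp6 B :=
  ((Matrix.GeneralLinearGroup.map f).comp (GSp6 A).subtype).codRestrict (GSp6 B)
    fun M => map_mem_GSp6 f M.2

/-- Functoriality of `PSp(6)` in the ring. -/
def PSp6.map (f : A →+* B) : PSp6 A →* PSp6 B :=
  QuotientGroup.map (GSp6.scalars A) (GSp6.scalars B) (GSp6.map f) <| by
    rintro ⟨M, hM⟩ ⟨u, rfl⟩
    refine ⟨Units.map f.toMonoidHom u, ?_⟩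
    ext i j
    simp [GSp6.map, Matrix.diagonal_apply, apply_ite f]

/-- Functoriality of `PGL(2)` in the ring. -/
def PGL2.map (f : A →+* B) : PGL(2, A) →* PGL(2, B) :=
  QuotientGroup.map _ _ (Matrix.GeneralLinearGroup.map f)
    (Matrix.GeneralLinearGroup.map_center_le f)

/-- The block diagonal matrix with blocks `a`, `a`, `d a d`, where `d = diag(1, -1)`. -/
def diagEmbMatrix (a : Matrix (Fin 2) (Fin 2) A) : Matrix (Fin 6) (Fin 6) A :=
  !![a 0 0, a 0 1, 0, 0, 0, 0;
     a 1 0, a 1 1, 0, 0, 0, 0;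
     0, 0, a 0 0, a 0 1, 0, 0;
     0, 0, a 1 0, a 1 1, 0, 0;
     0, 0, 0, 0, a 0 0, -a 0 1;
     0, 0, 0, 0, -a 1 0, a 1 1]

theorem diagEmbMatrix_one : diagEmbMatrix (1 : Matrix (Fin 2) (Fin 2) A) = 1 := by
  ext i j
  fin_cases i <;> fin_cases j <;> simp [diagEmbMatrix]

theorem diagEmbMatrix_mul (a b : Matrix (Fin 2) (Fin 2) A) :
    diagEmbMatrix (a * b) = diagEmbMatrix a * diagEmbMatrix b := by
  ext i j
  fin_cases i <;> fin_cases j <;>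
    simp [diagEmbMatrix, Matrix.mul_apply, Fin.sum_univ_succ] <;> ring

theorem diagEmbMatrix_similitude (a : Matrix (Fin 2) (Fin 2) A) :
    (diagEmbMatrix a).transpose * gram A * diagEmbMatrix a = a.det • gram A := by
  ext i j
  fin_cases i <;> fin_cases j <;>
    simp [diagEmbMatrix, gram, Matrix.mul_apply, Fin.sum_univ_succ, Matrix.det_fin_two] <;> ring

/-- The diagonal embedding `GL(2) → GSp(6)`. It acts on `V₁₂` and `V₃₄` by the given matrix in the
bases `v₁, v₂` and `v₃, v₄`, and on `V₅₆` in the way that is forced by the symplectic form. -/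
def diagEmbGL : GL (Fin 2) A →* GSp6 A :=
  (Units.map
    { toFun := diagEmbMatrix
      map_one' := diagEmbMatrix_one
      map_mul' := diagEmbMatrix_mul : Matrix (Fin 2) (Fin 2) A →* Matrix (Fin 6) (Fin 6) A}
    ).codRestrict (GSp6 A) fun a =>
      ⟨Matrix.GeneralLinearGroup.det a, diagEmbMatrix_similitude a.val⟩

/-- The diagonal embedding `PGL(2) → L ⊂ PSp(6)`. -/
def diagEmb : PGL(2, A) →* PSp6 A :=
  QuotientGroup.map (Subgroup.center (GL (Fin 2) A)) (GSp6.scalars A) diagEmbGL <| by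
    rw [Matrix.GeneralLinearGroup.center_eq_range_scalar]
    rintro _ ⟨u, rfl⟩
    refine ⟨u, ?_⟩
    ext i j
    change (Matrix.scalar (Fin 6) u.val) i j = diagEmbMatrix (Matrix.scalar (Fin 2) u.val) i j
    fin_cases i <;> fin_cases j <;> simp [diagEmbMatrix]

/-- The number of the block (`V₁₂`, `V₃₄` or `V₅₆`) that contains a basis vector. -/
def block (i : Fin 6) : ℕ := i.val / 2

/-- The unipotent radical of the stabilizer of `V₁₂`, in `GSp(6)`: the block upper unitriangular
matrices in `GSp(6)` (they automatically lie in `Sp(6)`). -/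
def unipotentGSp (A : Type*) [CommRing A] : Subgroup (GSp6 A) where
  carrier := {u | ∀ i j, block j ≤ block i →
    u.val.val i j = (1 : Matrix (Fin 6) (Fin 6) A) i j}
  one_mem' := fun _ _ _ => rfl
  mul_mem' := by
    intro u v hu hv i j hij
    simp only [Subgroup.coe_mul, Units.val_mul, Matrix.mul_apply]
    rw [Finset.sum_eq_single i]
    · by_cases h : i = j
      · subst h; simp [hu i i le_rfl, hv i i le_rfl]
      · simp [hu i i le_rfl, hv i j hij, h]
    · intro k _ hk
      rcases le_total (block k) (block i) with h | h
      · rw [hu i k h, Matrix.one_apply_ne (Ne.symm hk), zero_mul]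
      · rw [hv k j (hij.trans h)]
        by_cases hkj : k = j
        · subst hkj
          rw [hu i k hij, Matrix.one_apply_ne (Ne.symm hk), zero_mul]
        · rw [Matrix.one_apply_ne hkj, mul_zero]
    · simp
  inv_mem' := by
    intro u hu
    have key : ∀ i j, ((u⁻¹ : GSp6 A).val.val * u.val.val) i j
        = (1 : Matrix (Fin 6) (Fin 6) A) i j := by
      intro i j
      simp
    -- column by column: `(u⁻¹) i j = δ i j - ∑_{block k < block j} (u⁻¹) i k * u k j`
    have step : ∀ (n : ℕ) (i j : Fin 6), block j = n → block j ≤ block i →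
        (u⁻¹ : GSp6 A).val.val i j = (1 : Matrix (Fin 6) (Fin 6) A) i j := by
      intro n
      induction n using Nat.strong_induction_on with
      | _ n ih =>
        intro i j hj hij
        rw [← key i j, Matrix.mul_apply, Finset.sum_eq_single j]
        · rw [hu j j le_rfl, Matrix.one_apply_eq, mul_one]
        · intro k _ hk
          rcases lt_or_ge (block k) (block j) with h | h
          · rw [ih (block k) (hj ▸ h) i k rfl (h.le.trans hij), Matrix.one_apply_ne, zero_mul]
            rintro rfl
            exact absurd hij (not_le.mpr h)
          · rw [hu k j h, Matrix.one_apply_ne hk, mul_zero]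
        · simp
    intro i j hij
    exact step _ i j rfl hij

/-- The unipotent subgroup `U(A) ⊂ PSp(6, A)`. -/
def unipotent (A : Type*) [CommRing A] : Subgroup (PSp6 A) := (unipotentGSp A).map PSp6.mk

/-- The element `Id + c E₃₄` as a unit in the matrix ring. -/
def transvectionGL (c : A) : GL (Fin 6) A where
  val := Matrix.transvection 2 3 c
  inv := Matrix.transvection 2 3 (-c)
  val_inv := by rw [Matrix.transvection_mul_transvection_same _ _ (by decide)]; simp
  inv_val := by rw [Matrix.transvection_mul_transvection_same _ _ (by decide)]; simp

/-- The element `g = Id + E₃₄` of `PSp(6)`. -/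
def gElt (A : Type*) [CommRing A] : PSp6 A :=
  PSp6.mk ⟨transvectionGL 1, 1, by
    ext i j
    fin_cases i <;> fin_cases j <;>
      simp [transvectionGL, Matrix.transvection, Matrix.single, gram, Matrix.mul_apply,
        Fin.sum_univ_six, Matrix.one_apply]⟩

/-- The element `diag(x, y, z, c/z, c/y, c/x)` of `GSp(6)`. -/
def torusGSp (x y z c : Aˣ) : GSp6 A :=
  ⟨{ val := Matrix.diagonal fun i => (![x, y, z, c / z, c / y, c / x] i : Aˣ).val
     inv := Matrix.diagonal fun i => ((![x, y, z, c / z, c / y, c / x] i)⁻¹ : Aˣ).val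
     val_inv := by simp
     inv_val := by simp }, c, by
    ext i j
    fin_cases i <;> fin_cases j <;>
      simp [gram, div_eq_mul_inv, mul_comm, ← Units.val_mul]⟩

end Groups

/-! ### The loop groups and the affine Grassmannians -/

/-- `𝐎 = ℂ[[t]]`. -/
abbrev OO : Type := PowerSeries ℂ

/-- `𝐅 = ℂ((t))`. -/
abbrev FF : Type := LaurentSeries ℂ

/-- The inclusion `𝐎 → 𝐅`. -/
def inclOF : OO →+* FF := HahnSeries.ofPowerSeries ℤ ℂ

/-- The ring homomorphism `R((t)) → S((t))` induced by a homomorphism `R → S`. -/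
def laurentMap {R S : Type*} [CommRing R] [CommRing S] (f : R →+* S) :
    LaurentSeries R →+* LaurentSeries S where
  toFun x := HahnSeries.map x f
  map_zero' := by ext n; simp
  map_one' := HahnSeries.map_one f.toMonoidWithZeroHom
  map_add' x y := by ext n; simp
  map_mul' x y := HahnSeries.map_mul (f : R →ₙ+* S)

/-- The uniformizer `t ∈ 𝐅ˣ`. -/
def tUnit : FFˣ := Units.mk0 (HahnSeries.single 1 1) (by simp)

/-- The coweight `t^{(λ₁, λ₂, λ₃)} ∈ PSp(6, 𝐅)`. It is the class of
`diag(t^{λ₁}, t^{λ₂}, t^{λ₃}, t^{-λ₃}, t^{-λ₂}, t^{-λ₁})`, written after multiplication by the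
scalar `t^{λ₁}`, which makes all the exponents integral for `λ ∈ X` (so the floors below are of
integers). -/
def tPowPSp6 (l : Fin 4 → ℚ) : PSp6 FF :=
  PSp6.mk (torusGSp (tUnit ^ ⌊2 * l 0⌋) (tUnit ^ ⌊l 0 + l 1⌋) (tUnit ^ ⌊l 0 + l 2⌋)
    (tUnit ^ ⌊2 * l 0⌋))

/-- The coweight `t^{λ₄} ∈ PGL(2, 𝐅)` for `λ₄ ∈ ½ℤ`: the class of `diag(t^{λ₄}, t^{-λ₄})`, that
is, of `diag(t^{2λ₄}, 1)`. -/
def tPowPGL2 (l : Fin 4 → ℚ) : PGL(2, FF) :=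
  Matrix.ProjGenLinGroup.mk
    { val := Matrix.diagonal fun i => (![tUnit ^ ⌊2 * l 3⌋, 1] i : FFˣ).val
      inv := Matrix.diagonal fun i => ((![tUnit ^ ⌊2 * l 3⌋, 1] i)⁻¹ : FFˣ).val
      val_inv := by simp
      inv_val := by simp }

/-- The group `Ḡ = PGL(2) × PSp(6)`. -/
abbrev GBar (A : Type*) [CommRing A] : Type _ := PGL(2, A) × PSp6 A

/-- Functoriality of `Ḡ` in the ring. -/
def GBar.map {A B : Type*} [CommRing A] [CommRing B] (f : A →+* B) : GBar A →* GBar B :=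
  (PGL2.map f).prodMap (PSp6.map f)

/-- `(ℂ`-points of) the affine Grassmannian `Gr_{PSp(6)} = PSp(6, 𝐅) / PSp(6, 𝐎)`. -/
def GrPSp6 : Type := PSp6 FF ⧸ (PSp6.map inclOF).range

/-- `(ℂ`-points of) the affine Grassmannian `Gr_Ḡ = Ḡ(𝐅) / Ḡ(𝐎)`. -/
def GrGBar : Type := GBar FF ⧸ (GBar.map inclOF).range

/-- The projection `PSp(6, 𝐅) → Gr_{PSp(6)}`. -/
def GrPSp6.mk (M : PSp6 FF) : GrPSp6 := QuotientGroup.mk M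

/-- The projection `Ḡ(𝐅) → Gr_Ḡ`. -/
def GrGBar.mk (M : GBar FF) : GrGBar := QuotientGroup.mk M

instance : MulAction (PSp6 FF) GrPSp6 :=
  inferInstanceAs (MulAction (PSp6 FF) (PSp6 FF ⧸ (PSp6.map inclOF).range))

instance : MulAction (GBar FF) GrGBar :=
  inferInstanceAs (MulAction (GBar FF) (GBar FF ⧸ (GBar.map inclOF).range))

/-- The Zariski topology on the set `(Spec R)(ℂ)` of `ℂ`-points. -/
@[reducible] def zariskiPoints (R : Type) [CommRing R] [Algebra ℂ R] : TopologicalSpace (R →ₐ[ℂ] ℂ) :=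
  TopologicalSpace.induced
    (fun x => (⟨RingHom.ker x, RingHom.ker_isPrime x⟩ : PrimeSpectrum R)) inferInstance

/-- The Zariski topology of the ind-projective ind-scheme `Gr_{PSp(6)}`, on `ℂ`-points: the final
topology for all families `Spec R → Gr_{PSp(6)}`, with `R` a `ℂ`-algebra of finite type, that are
given by elements of `PSp(6, R((t)))`. So `Z` is closed if and only if for every such family `γ`
the set of `x ∈ (Spec R)(ℂ)` with `[γ(x)] ∈ Z` is Zariski closed. (The reduced
connected components of `Gr_{PSp(6)}` are isomorphic to that of `Gr_{Sp(6)}`, and every family over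
a variety in the latter lifts étale locally to the loop group of `Sp(6)`; so this is the topology in
which `Z` is closed if and only if its intersection with each closed subscheme of finite type is
Zariski closed.) -/
instance : TopologicalSpace GrPSp6 :=
  ⨆ (R : Type) (_ : CommRing R) (_ : Algebra ℂ R) (_ : Algebra.FiniteType ℂ R)
    (γ : PSp6 (LaurentSeries R)),
    TopologicalSpace.coinduced
      (fun x : R →ₐ[ℂ] ℂ => GrPSp6.mk (PSp6.map (laurentMap x.toRingHom) γ)) (zariskiPoints R)

/-- The Zariski topology of the ind-scheme `Gr_Ḡ`, on `ℂ`-points, defined in the same way. -/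
instance : TopologicalSpace GrGBar :=
  ⨆ (R : Type) (_ : CommRing R) (_ : Algebra ℂ R) (_ : Algebra.FiniteType ℂ R)
    (γ : GBar (LaurentSeries R)),
    TopologicalSpace.coinduced
      (fun x : R →ₐ[ℂ] ℂ => GrGBar.mk (GBar.map (laurentMap x.toRingHom) γ)) (zariskiPoints R)

/-! ### The orbits -/

/-- The subgroup `PGL(2, 𝐎) ⋉ U(𝐅)` of `PSp(6, 𝐅)`. -/
def orbitGroup : Subgroup (PSp6 FF) := (diagEmb.comp (PGL2.map inclOF)).range ⊔ unipotent FF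

/-- The subgroup `H(𝐅) = PGL(2, 𝐅) ⋉ U(𝐅)` of `Ḡ(𝐅)`, where `PGL(2)` is embedded diagonally. -/
def HF : Subgroup (GBar FF) :=
  ((MonoidHom.id PGL(2, FF)).prod diagEmb).range ⊔
    (unipotent FF).map (MonoidHom.inr PGL(2, FF) (PSp6 FF))

/-- The representative `t^{λ₄} g t^{(λ₁, λ₂, λ₃)} ∈ PSp(6, 𝐅)`. -/
def rep (l : Fin 4 → ℚ) : PSp6 FF := diagEmb (tPowPGL2 l) * gElt FF * tPowPSp6 l

/-- The `PGL(2, 𝐎) ⋉ U(𝐅)`-orbit of the point `t^{λ₄} g t^{(λ₁, λ₂, λ₃)}` in `Gr_{PSp(6)}`. -/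
def orbitPSp6 (l : Fin 4 → ℚ) : Set GrPSp6 := MulAction.orbit orbitGroup (GrPSp6.mk (rep l))

/-- The corresponding `H(𝐅)`-orbit in `Gr_Ḡ = Gr_{PGL(2)} × Gr_{PSp(6)}`, namely the orbit of the
point `(1, t^{λ₄} g t^{(λ₁, λ₂, λ₃)})`. -/
def orbitGBar (l : Fin 4 → ℚ) : Set GrGBar := MulAction.orbit HF (GrGBar.mk (1, rep l))

end GaiottoF4

end

noncomputable section

namespace GaiottoF4

open scoped Topology

/-! ### Functoriality of the groups -/

section Functoriality

variable {A B C : Type*} [CommRing A] [CommRing B] [CommRing C]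

/-! The two closure relations agree because the two orbit problems do. Projection of `HF` to the
first factor is onto with kernel `unipotent FF`, so sending `(a, M)` to `(diagEmb a)⁻¹ * M`
identifies `HF`-orbits in the product with `orbitGroup`-orbits in `GrPSp6`. This map involves a
choice of `a` modulo `PGL(2, 𝐎)`, which the left action of `orbitGroup` absorbs. A closed set on
either side yields a closed set on the other, since closedness is tested on families and a family
may be translated by constant loops, or multiplied by the inverse of its own first component.

For the root inequality, four polynomial functions on matrices, invariant under left multiplication
by the unipotent radical and normalized by the similitude factor, are used as valuations. "All
values on `PGL(2, 𝐎) M PSp(6, 𝐎)` vanish to order at least `n`" is a closed condition on `M`, stable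
under the orbit group (`SemiInvariant.OrderGE.of_subset_closure`), so the minimal order can only
increase on passing to the closure (`SemiInvariant.HasOrder.le`). If `l - l' = ∑ aᵢ αᵢ`, then the
differences of the coordinate sums `l 0 + l 3`, `l 0 + l 1 + l 2 + l 3`, `2 * l 0 + l 1 + l 2`, `l 0
+ l 1` are `a₁, a₂, a₃, a₄`. The minimal orders at the representatives are minus these sums, doubled
for the first two, where odd degree forces the invariant to be squared. This gives nonnegativity of
all `aᵢ` and integrality of `a₃, a₄`.

Integrality of `a₁` comes from connected components: the parity of the order of the similitude
factor is locally constant (`HasParity.of_subset_closure`). Then `a₂ = a₁ + a₃ - 2 (l 0 - l' 0)` is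
an integer as well. -/

theorem PSp6.mk_surjective : Function.Surjective (PSp6.mk : GSp6 A → PSp6 A) :=
  QuotientGroup.mk'_surjective _

theorem PSp6.map_mk (f : A →+* B) (M : GSp6 A) :
    PSp6.map f (PSp6.mk M) = PSp6.mk (GSp6.map f M) := rfl

theorem GSp6.map_val (f : A →+* B) (M : GSp6 A) :
    (GSp6.map f M).val.val = M.val.val.map f := rfl

theorem diagEmb_mk (a : GL (Fin 2) A) :
    diagEmb (Matrix.ProjGenLinGroup.mk a) = PSp6.mk (diagEmbGL a) := rfl

theorem PGL2.map_mk (f : A →+* B) (a : GL (Fin 2) A) :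
    PGL2.map f (Matrix.ProjGenLinGroup.mk a) =
      Matrix.ProjGenLinGroup.mk (Matrix.GeneralLinearGroup.map f a) := rfl

theorem diagEmbMatrix_map (f : A →+* B) (a : Matrix (Fin 2) (Fin 2) A) :
    diagEmbMatrix (a.map f) = (diagEmbMatrix a).map f := by
  ext i j
  fin_cases i <;> fin_cases j <;> simp [diagEmbMatrix]

theorem diagEmbGL_map (f : A →+* B) (a : GL (Fin 2) A) :
    diagEmbGL (Matrix.GeneralLinearGroup.map f a) = GSp6.map f (diagEmbGL a) :=
  Subtype.ext (Units.ext (diagEmbMatrix_map f a.val))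

theorem diagEmb_map (f : A →+* B) (a : PGL(2, A)) :
    diagEmb (PGL2.map f a) = PSp6.map f (diagEmb a) := by
  obtain ⟨a, rfl⟩ := QuotientGroup.mk_surjective a
  exact congrArg PSp6.mk (diagEmbGL_map f a)

theorem PSp6.map_map (f : A →+* B) (g : B →+* C) (M : PSp6 A) :
    PSp6.map g (PSp6.map f M) = PSp6.map (g.comp f) M := by
  obtain ⟨M, rfl⟩ := PSp6.mk_surjective M
  rfl

theorem PSp6.map_id (M : PSp6 A) : PSp6.map (RingHom.id A) M = M := by
  obtain ⟨M, rfl⟩ := PSp6.mk_surjective M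
  rfl

theorem PGL2.map_map (f : A →+* B) (g : B →+* C) (M : PGL(2, A)) :
    PGL2.map g (PGL2.map f M) = PGL2.map (g.comp f) M := by
  obtain ⟨M, rfl⟩ := QuotientGroup.mk_surjective M
  rfl

theorem PGL2.map_id (M : PGL(2, A)) : PGL2.map (RingHom.id A) M = M := by
  obtain ⟨M, rfl⟩ := QuotientGroup.mk_surjective M
  rfl

/-! ### The unipotent radical is normalized by the Levi subgroup -/

theorem diagEmbMatrix_apply_eq_zero (a : Matrix (Fin 2) (Fin 2) A) {i j : Fin 6}
    (h : block i ≠ block j) : diagEmbMatrix a i j = 0 := by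
  fin_cases i <;> fin_cases j <;> simp [block, diagEmbMatrix] at h ⊢

/-- Write `u = 1 + n` with `n` strictly block upper triangular; conjugation by a block diagonal
matrix preserves this shape. -/
theorem conj_mem_unipotentGSp (a : GL (Fin 2) A) {u : GSp6 A} (hu : u ∈ unipotentGSp A) :
    diagEmbGL a * u * (diagEmbGL a)⁻¹ ∈ unipotentGSp A := by
  intro i j hij
  rw [← map_inv]
  have hmul : (diagEmbGL a * u * diagEmbGL a⁻¹).val.val =
      1 + diagEmbMatrix a.val * (u.val.val - 1) * diagEmbMatrix (a⁻¹).val := by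
    have h1 : diagEmbMatrix a.val * diagEmbMatrix (a⁻¹).val = 1 := by
      rw [← diagEmbMatrix_mul, ← diagEmbMatrix_one]
      exact congrArg diagEmbMatrix (by simp)
    rw [Matrix.mul_sub, Matrix.sub_mul, Matrix.mul_one, h1, add_sub_cancel]
    rfl
  rw [hmul, Matrix.add_apply, add_eq_left, Matrix.mul_apply]
  refine Finset.sum_eq_zero fun l _ => ?_
  by_cases hl : block l = block j
  · rw [Matrix.mul_apply, Finset.sum_eq_zero, zero_mul]
    intro k _
    by_cases hk : block i = block k
    · rw [Matrix.sub_apply, hu k l (by omega), sub_self, mul_zero]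
    · rw [diagEmbMatrix_apply_eq_zero _ hk, zero_mul]
  · rw [diagEmbMatrix_apply_eq_zero _ hl, mul_zero]

theorem diagEmb_conj_mem_unipotent (a : PGL(2, A)) {u : PSp6 A} (hu : u ∈ unipotent A) :
    diagEmb a * u * (diagEmb a)⁻¹ ∈ unipotent A := by
  obtain ⟨a, rfl⟩ := QuotientGroup.mk_surjective a
  obtain ⟨u, hu, rfl⟩ := hu
  exact ⟨_, conj_mem_unipotentGSp a hu, rfl⟩

theorem range_le_normalizer_of_conj_mem {G N : Type*} [Group G] [Group N] (f : N →* G)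
    (U : Subgroup G) (h : ∀ a, ∀ u ∈ U, f a * u * (f a)⁻¹ ∈ U) :
    f.range ≤ Subgroup.normalizer (U : Set G) := by
  rintro _ ⟨a, rfl⟩
  rw [Subgroup.mem_normalizer_iff]
  refine fun u => ⟨h a u, fun hu => ?_⟩
  simpa [mul_assoc] using h a⁻¹ _ hu

end Functoriality

/-! ### Normal forms for elements of the two acting groups -/

theorem mem_orbitGroup_iff {x : PSp6 FF} :
    x ∈ orbitGroup ↔ ∃ k : PGL(2, OO), ∃ u ∈ unipotent FF,
      x = diagEmb (PGL2.map inclOF k) * u := by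
  have hN := range_le_normalizer_of_conj_mem (diagEmb.comp (PGL2.map inclOF)) (unipotent FF)
    fun a u hu => diagEmb_conj_mem_unipotent _ hu
  rw [orbitGroup, ← SetLike.mem_coe, Subgroup.coe_mul_of_left_le_normalizer_right _ _ hN]
  constructor
  · rintro ⟨_, ⟨k, rfl⟩, u, hu, rfl⟩
    exact ⟨k, u, hu, rfl⟩
  · rintro ⟨k, u, hu, rfl⟩
    exact ⟨_, ⟨k, rfl⟩, u, hu, rfl⟩

theorem diagEmb_mem_orbitGroup (k : PGL(2, OO)) :
    diagEmb (PGL2.map inclOF k) ∈ orbitGroup :=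
  mem_orbitGroup_iff.2 ⟨k, 1, one_mem _, (mul_one _).symm⟩

theorem unipotent_le_orbitGroup : unipotent FF ≤ orbitGroup := le_sup_right

theorem mem_HF_iff {x : GBar FF} :
    x ∈ HF ↔ ∃ u ∈ unipotent FF, x.2 = diagEmb x.1 * u := by
  have hN := range_le_normalizer_of_conj_mem ((MonoidHom.id PGL(2, FF)).prod diagEmb)
    ((unipotent FF).map (MonoidHom.inr PGL(2, FF) (PSp6 FF))) (by
      rintro a _ ⟨u, hu, rfl⟩
      exact ⟨_, diagEmb_conj_mem_unipotent a hu, by ext <;> simp⟩)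
  rw [HF, ← SetLike.mem_coe, Subgroup.coe_mul_of_left_le_normalizer_right _ _ hN]
  constructor
  · rintro ⟨_, ⟨k, rfl⟩, _, ⟨u, hu, rfl⟩, rfl⟩
    exact ⟨u, hu, by simp⟩
  · rintro ⟨u, hu, hx⟩
    exact ⟨_, ⟨x.1, rfl⟩, _, ⟨u, hu, rfl⟩, by ext <;> simp [hx]⟩

/-! ### Closed subsets of the affine Grassmannians -/

theorem isClosed_GrPSp6_iff {Z : Set GrPSp6} :
    IsClosed Z ↔ ∀ (R : Type) (_ : CommRing R) (_ : Algebra ℂ R) (_ : Algebra.FiniteType ℂ R)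
      (γ : PSp6 (LaurentSeries R)), IsClosed[zariskiPoints R]
        {x | GrPSp6.mk (PSp6.map (laurentMap x.toRingHom) γ) ∈ Z} := by
  simp only [isClosed_iSup_iff, isClosed_coinduced]
  rfl

theorem isClosed_GrGBar_iff {Z : Set GrGBar} :
    IsClosed Z ↔ ∀ (R : Type) (_ : CommRing R) (_ : Algebra ℂ R) (_ : Algebra.FiniteType ℂ R)
      (γ : GBar (LaurentSeries R)), IsClosed[zariskiPoints R]
        {x | GrGBar.mk (GBar.map (laurentMap x.toRingHom) γ) ∈ Z} := by
  simp only [isClosed_iSup_iff, isClosed_coinduced]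
  rfl

theorem isClosed_zariskiPoints_eq_zero {R : Type} [CommRing R] [Algebra ℂ R] (r : R) :
    IsClosed[zariskiPoints R] {x : R →ₐ[ℂ] ℂ | x r = 0} := by
  let _ := zariskiPoints R
  rw [isClosed_induced_iff]
  refine ⟨_, PrimeSpectrum.isClosed_zeroLocus {r}, ?_⟩
  ext x
  simp [PrimeSpectrum.mem_zeroLocus]

/-- The constant families: the inclusion `𝐅 → R((t))`. -/
def constFF (R : Type*) [CommRing R] [Algebra ℂ R] : FF →+* LaurentSeries R :=
  laurentMap (algebraMap ℂ R)

theorem laurentMap_comp_constFF {R : Type*} [CommRing R] [Algebra ℂ R] (x : R →ₐ[ℂ] ℂ) :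
    (laurentMap (x : R →+* ℂ)).comp (constFF R) = RingHom.id FF := by
  ext f n
  exact x.commutes (f.coeff n)

theorem PSp6.laurentMap_constFF {R : Type*} [CommRing R] [Algebra ℂ R] (x : R →ₐ[ℂ] ℂ)
    (M : PSp6 FF) : PSp6.map (laurentMap (x : R →+* ℂ)) (PSp6.map (constFF R) M) = M := by
  rw [PSp6.map_map, laurentMap_comp_constFF, PSp6.map_id]

theorem PGL2.laurentMap_constFF {R : Type*} [CommRing R] [Algebra ℂ R] (x : R →ₐ[ℂ] ℂ)
    (M : PGL(2, FF)) : PGL2.map (laurentMap (x : R →+* ℂ)) (PGL2.map (constFF R) M) = M := by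
  rw [PGL2.map_map, laurentMap_comp_constFF, PGL2.map_id]

/-! ### Cosets and orbit membership in terms of representatives -/

theorem GrPSp6.mk_eq_mk_iff {M N : PSp6 FF} :
    GrPSp6.mk M = GrPSp6.mk N ↔ ∃ P : PSp6 OO, N = M * PSp6.map inclOF P := by
  refine QuotientGroup.eq.trans ⟨?_, ?_⟩
  · rintro ⟨P, hP⟩
    exact ⟨P, by rw [hP, mul_inv_cancel_left]⟩
  · rintro ⟨P, rfl⟩
    exact ⟨P, by rw [inv_mul_cancel_left]⟩

theorem GrGBar.mk_eq_mk_iff {M N : GBar FF} :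
    GrGBar.mk M = GrGBar.mk N ↔ ∃ P : GBar OO, N = M * GBar.map inclOF P := by
  refine QuotientGroup.eq.trans ⟨?_, ?_⟩
  · rintro ⟨P, hP⟩
    exact ⟨P, by rw [hP, mul_inv_cancel_left]⟩
  · rintro ⟨P, rfl⟩
    exact ⟨P, by rw [inv_mul_cancel_left]⟩

theorem GrPSp6.mk_surjective : Function.Surjective GrPSp6.mk := QuotientGroup.mk_surjective

theorem GrGBar.mk_surjective : Function.Surjective GrGBar.mk := QuotientGroup.mk_surjective

theorem mk_mem_orbitPSp6_iff {l : Fin 4 → ℚ} {M : PSp6 FF} :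
    GrPSp6.mk M ∈ orbitPSp6 l ↔
      ∃ g ∈ orbitGroup, ∃ P : PSp6 OO, M = g * rep l * PSp6.map inclOF P := by
  constructor
  · rintro ⟨⟨g, hg⟩, h⟩
    exact ⟨g, hg, GrPSp6.mk_eq_mk_iff.1 h⟩
  · rintro ⟨g, hg, h⟩
    exact ⟨⟨g, hg⟩, GrPSp6.mk_eq_mk_iff.2 h⟩

theorem mk_mem_orbitGBar_iff {l : Fin 4 → ℚ} {M : GBar FF} :
    GrGBar.mk M ∈ orbitGBar l ↔
      ∃ g ∈ HF, ∃ P : GBar OO, M = g * (1, rep l) * GBar.map inclOF P := by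
  constructor
  · rintro ⟨⟨g, hg⟩, h⟩
    exact ⟨g, hg, GrGBar.mk_eq_mk_iff.1 h⟩
  · rintro ⟨g, hg, h⟩
    exact ⟨⟨g, hg⟩, GrGBar.mk_eq_mk_iff.2 h⟩

/-! ### Comparison of the two closure relations -/

theorem orbitGBar_subset_closure_of_orbitPSp6 {l l' : Fin 4 → ℚ}
    (h : orbitPSp6 l' ⊆ closure (orbitPSp6 l)) : orbitGBar l' ⊆ closure (orbitGBar l) := by
  rintro _ ⟨⟨a, ha⟩, rfl⟩
  -- Preimage of the closure under `z ↦ a • (1, z)`. Quantifying over all representatives makes it a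
  -- set of cosets; `hZ` shows that one representative suffices.
  let Z : Set GrPSp6 := {z | ∀ M, GrPSp6.mk M = z → GrGBar.mk (a * (1, M)) ∈ closure (orbitGBar l)}
  have hZ : ∀ M, GrPSp6.mk M ∈ Z ↔ GrGBar.mk (a * (1, M)) ∈ closure (orbitGBar l) := by
    refine fun M => ⟨fun hM => hM M rfl, fun hM N hN => ?_⟩
    obtain ⟨P, rfl⟩ := GrPSp6.mk_eq_mk_iff.1 hN
    convert hM using 1
    exact GrGBar.mk_eq_mk_iff.2 ⟨(1, P), by
      ext <;> simp [GBar.map, mul_assoc]⟩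
  have hclosed : IsClosed Z := by
    rw [isClosed_GrPSp6_iff]
    intro R _ _ _ γ
    have := isClosed_GrGBar_iff.1 (isClosed_closure (s := orbitGBar l)) R _ _ inferInstance
      -- The family `(1, γ)` translated by the constant loop `a`.
      (PGL2.map (constFF R) a.1, PSp6.map (constFF R) a.2 * γ)
    convert this using 3 with x
    rw [hZ]
    congr! 2
    ext
    · simp [GBar.map, PGL2.laurentMap_constFF]
    · simp [GBar.map, PSp6.laurentMap_constFF]
  have hsub : orbitPSp6 l ⊆ Z := by
    intro z hz
    obtain ⟨M, rfl⟩ := GrPSp6.mk_surjective z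
    rw [hZ]
    apply subset_closure
    obtain ⟨g, hg, P, rfl⟩ := mk_mem_orbitPSp6_iff.1 hz
    obtain ⟨k, u, hu, rfl⟩ := mem_orbitGroup_iff.1 hg
    -- The `PGL(2)`-part `k` of an orbit group element is integral, so in the first factor it is
    -- undone by right multiplication with `k⁻¹`.
    refine mk_mem_orbitGBar_iff.2
      ⟨a * (PGL2.map inclOF k, diagEmb (PGL2.map inclOF k) * u),
        mul_mem ha (mem_HF_iff.2 ⟨u, hu, rfl⟩), (k⁻¹, P), ?_⟩
    ext <;> simp [GBar.map, mul_assoc]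
  exact (hZ _).1 (closure_minimal hsub hclosed (h (MulAction.mem_orbit_self _)))

theorem orbitPSp6_subset_closure_of_orbitGBar {l l' : Fin 4 → ℚ}
    (h : orbitGBar l' ⊆ closure (orbitGBar l)) : orbitPSp6 l' ⊆ closure (orbitPSp6 l) := by
  rintro _ ⟨⟨g, hg⟩, rfl⟩
  -- Another representative changes `M.1` by an integral factor on the right, which appears to the
  -- left of `(diagEmb M.1)⁻¹ * M.2`; letting `g` run over all of `orbitGroup` absorbs it.
  let W : Set GrGBar := {w | ∀ M, GrGBar.mk M = w → ∀ g ∈ orbitGroup,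
    GrPSp6.mk (g * (diagEmb M.1)⁻¹ * M.2) ∈ closure (orbitPSp6 l)}
  have hW : ∀ M, GrGBar.mk M ∈ W ↔ ∀ g ∈ orbitGroup,
      GrPSp6.mk (g * (diagEmb M.1)⁻¹ * M.2) ∈ closure (orbitPSp6 l) := by
    refine fun M => ⟨fun hM => hM M rfl, fun hM N hN g hg => ?_⟩
    obtain ⟨P, rfl⟩ := GrGBar.mk_eq_mk_iff.1 hN
    have hmem := mul_mem hg (diagEmb_mem_orbitGroup P.1)
    convert hM _ hmem using 1
    exact GrPSp6.mk_eq_mk_iff.2 ⟨P.2, by simp [GBar.map, mul_assoc]⟩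
  have hclosed : IsClosed W := by
    rw [isClosed_GrGBar_iff]
    intro R _ _ _ γ
    let _ := zariskiPoints R
    simp only [hW, Set.ofPred_forall]
    refine isClosed_iInter fun g => isClosed_iInter fun _ => ?_
    have := isClosed_GrPSp6_iff.1 (isClosed_closure (s := orbitPSp6 l)) R _ _ inferInstance
      (PSp6.map (constFF R) g * (diagEmb γ.1)⁻¹ * γ.2)
    convert this using 3 with x
    simp [GBar.map, PSp6.laurentMap_constFF, diagEmb_map]
  have hsub : orbitGBar l ⊆ W := by
    intro w hw
    obtain ⟨M, rfl⟩ := GrGBar.mk_surjective w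
    rw [hW]
    intro g hg
    apply subset_closure
    obtain ⟨b, hb, P, rfl⟩ := mk_mem_orbitGBar_iff.1 hw
    obtain ⟨u, hu, hbu⟩ := mem_HF_iff.1 hb
    refine mk_mem_orbitPSp6_iff.2 ⟨g * (diagEmb (PGL2.map inclOF P.1))⁻¹ * u, ?_, P.2, ?_⟩
    · rw [← map_inv, ← map_inv]
      exact mul_mem (mul_mem hg (diagEmb_mem_orbitGroup _)) (unipotent_le_orbitGroup hu)
    · simp [GBar.map, hbu, mul_assoc]
  have key := (hW _).1 (closure_minimal hsub hclosed (h (MulAction.mem_orbit_self _))) g hg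
  simp only [map_one, inv_one, mul_one] at key
  exact key

/-! ### The similitude character -/

section Similitude

variable {A B : Type*} [CommRing A] [CommRing B]

theorem gram_zero_five : gram A 0 5 = 1 := by simp [gram]

theorem similitude_apply_eq {M : Matrix (Fin 6) (Fin 6) A} {c : A}
    (h : M.transpose * gram A * M = c • gram A) : (M.transpose * gram A * M) 0 5 = c := by
  rw [h, Matrix.smul_apply, gram_zero_five, smul_eq_mul, mul_one]

/-- The similitude character `GSp(6) → 𝔾ₘ`. -/
def similitude : GSp6 A →* Aˣ :=
  MonoidHom.toHomUnits
    { toFun := fun M => (M.val.val.transpose * gram A * M.val.val) 0 5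
      map_one' := similitude_apply_eq (c := 1) (by simp)
      map_mul' := by
        rintro ⟨M, c, hM⟩ ⟨N, d, hN⟩
        rw [similitude_apply_eq hM, similitude_apply_eq hN]
        apply similitude_apply_eq
        have : (M * N).val.transpose * gram A * (M * N).val
            = N.val.transpose * (M.val.transpose * gram A * M.val) * N.val := by
          simp only [Units.val_mul, Matrix.transpose_mul, Matrix.mul_assoc]
        exact this.trans (by rw [hM, Matrix.mul_smul, Matrix.smul_mul, hN, smul_smul]) }

theorem similitude_val (M : GSp6 A) :
    (similitude M).val = (M.val.val.transpose * gram A * M.val.val) 0 5 := rfl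

theorem transpose_mul_gram_mul (M : GSp6 A) :
    M.val.val.transpose * gram A * M.val.val = (similitude M).val • gram A := by
  obtain ⟨c, hc⟩ := M.2
  rw [similitude_val, similitude_apply_eq hc, hc]

theorem similitude_eq {M : GSp6 A} {c : Aˣ}
    (h : M.val.val.transpose * gram A * M.val.val = c.val • gram A) : similitude M = c :=
  Units.ext (similitude_apply_eq h)

theorem similitude_diagEmbGL (a : GL (Fin 2) A) :
    similitude (diagEmbGL a) = Matrix.GeneralLinearGroup.det a :=
  similitude_eq (diagEmbMatrix_similitude a.val)

theorem gram_map (f : A →+* B) : (gram A).map f = gram B := by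
  ext i j
  simp only [gram, Matrix.map_apply, Matrix.of_apply]
  split_ifs <;> simp

theorem similitude_map (f : A →+* B) (M : GSp6 A) :
    similitude (GSp6.map f M) = Units.map f.toMonoidHom (similitude M) := by
  ext
  rw [similitude_val, GSp6.map_val, ← gram_map f, ← Matrix.transpose_map, ← Matrix.map_mul,
    ← Matrix.map_mul]
  rfl

theorem similitude_scalar (u : Aˣ) :
    similitude ⟨Matrix.GeneralLinearGroup.scalar (Fin 6) u, scalar_mem_GSp6 u⟩ = u * u :=
  similitude_eq (by simp [← Matrix.smul_one_eq_diagonal, smul_smul])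

theorem unipotent_apply_self {u : GSp6 A} (hu : u ∈ unipotentGSp A) (i : Fin 6) :
    u.val.val i i = 1 := by
  rw [hu i i le_rfl, Matrix.one_apply_eq]

theorem unipotent_apply_of_ne {u : GSp6 A} (hu : u ∈ unipotentGSp A) {i j : Fin 6}
    (h : block j ≤ block i) (hij : i ≠ j) : u.val.val i j = 0 := by
  rw [hu i j h, Matrix.one_apply_ne hij]

/-- The entry in row 3 and column 4 of the Gram relation only sees the middle block of `u`, which is
the identity. -/
theorem similitude_unipotent {u : GSp6 A} (hu : u ∈ unipotentGSp A) : similitude u = 1 := by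
  have h := congrFun (congrFun (transpose_mul_gram_mul u) 2) 3
  have h0 : gram A 2 3 = 1 := by simp [gram]
  rw [Matrix.smul_apply, h0, smul_eq_mul, mul_one] at h
  ext
  rw [← h, Matrix.mul_assoc]
  have e1 := unipotent_apply_self hu
  simp [Matrix.mul_apply, Fin.sum_univ_six, gram, e1,
    unipotent_apply_of_ne hu (i := 3) (j := 2) (by decide) (by decide),
    unipotent_apply_of_ne hu (i := 4) (j := 2) (by decide) (by decide),
    unipotent_apply_of_ne hu (i := 5) (j := 2) (by decide) (by decide),
    unipotent_apply_of_ne hu (i := 4) (j := 3) (by decide) (by decide),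
    unipotent_apply_of_ne hu (i := 5) (j := 3) (by decide) (by decide)]

theorem PSp6.mk_eq_mk_iff {M N : GSp6 A} :
    PSp6.mk M = PSp6.mk N ↔ ∃ u : Aˣ,
      N = M * ⟨Matrix.GeneralLinearGroup.scalar (Fin 6) u, scalar_mem_GSp6 u⟩ := by
  refine QuotientGroup.eq.trans ⟨?_, ?_⟩
  · rintro ⟨u, hu⟩
    refine ⟨u, ?_⟩
    rw [← inv_mul_eq_iff_eq_mul]
    exact Subtype.ext hu.symm
  · rintro ⟨u, rfl⟩
    exact ⟨u, by simp⟩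

end Similitude

/-! ### Powers of the uniformizer -/

theorem tUnit_zpow (m : ℤ) :
    (tUnit ^ m : FFˣ).val = HahnSeries.single m (1 : ℂ) := by
  rw [Units.val_zpow_eq_zpow_val]
  exact (RatFunc.single_zpow m).symm

theorem coeff_tUnit_zpow_mul_inclOF (m : ℤ) (o : OO) (j : ℤ) :
    ((tUnit ^ m : FFˣ).val * inclOF o).coeff j = (inclOF o).coeff (j - m) := by
  rw [tUnit_zpow, HahnSeries.coeff_single_mul, one_mul]

theorem coeff_inclOF_of_neg (o : OO) {j : ℤ} (hj : j < 0) :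
    (inclOF o).coeff j = 0 := by
  rw [inclOF, HahnSeries.ofPowerSeries_apply]
  apply HahnSeries.embDomain_of_notMem_range
  rintro ⟨n, hn⟩
  simp at hn
  omega

theorem mul_mul_inv_pow {G : Type*} [CommGroup G] (a b c : G) (w : ℕ) :
    (a * b * c)⁻¹ ^ w = (b ^ w)⁻¹ * (a⁻¹ * c⁻¹) ^ w := by
  rw [mul_comm a b, mul_assoc, mul_inv, mul_inv, mul_pow, inv_pow]

/-! ### Semi-invariant functions -/

/-- A homogeneous polynomial function of degree `2 * weight` on `6 × 6`-matrices, given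
functorially in the ring of coefficients, that is invariant under left multiplication by the
unipotent radical. -/
structure SemiInvariant where
  /-- half the degree -/
  weight : ℕ
  /-- the function -/
  toFun : ∀ {A : Type} [CommRing A], Matrix (Fin 6) (Fin 6) A → A
  map_toFun : ∀ {A B : Type} [CommRing A] [CommRing B] (f : A →+* B)
    (M : Matrix (Fin 6) (Fin 6) A), toFun (M.map f) = f (toFun M)
  toFun_smul : ∀ {A : Type} [CommRing A] (c : A) (M : Matrix (Fin 6) (Fin 6) A),
    toFun (c • M) = (c * c) ^ weight * toFun M
  toFun_unipotent_mul : ∀ {A : Type} [CommRing A] {u : GSp6 A} (_ : u ∈ unipotentGSp A)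
    (M : Matrix (Fin 6) (Fin 6) A), toFun (u.val.val * M) = toFun M

namespace SemiInvariant

variable (I : SemiInvariant) {A B : Type} [CommRing A] [CommRing B]

/-- The function on `GSp(6)` obtained by dividing by a power of the similitude character. -/
def onGSp (M : GSp6 A) : A := I.toFun M.val.val * ((similitude M)⁻¹ ^ I.weight : Aˣ).val

/-- The function on `PSp(6)` induced by a semi-invariant. -/
def onPSp (M : PSp6 A) : A :=
  Quotient.liftOn' M I.onGSp <| by
    intro M N h
    obtain ⟨u, rfl⟩ := PSp6.mk_eq_mk_iff.1 (Quotient.sound' h : PSp6.mk M = PSp6.mk N)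
    have : (M * ⟨Matrix.GeneralLinearGroup.scalar (Fin 6) u, scalar_mem_GSp6 u⟩ : GSp6 A).val.val
        = u.val • M.val.val := by
      ext i j
      simp [mul_comm]
    rw [onGSp, onGSp, this, I.toFun_smul, map_mul, similitude_scalar, mul_inv,
      mul_pow (similitude M)⁻¹, Units.val_mul, ← Units.val_mul u u, ← Units.val_pow_eq_pow_val,
      inv_pow (u * u)]
    set v := (u * u) ^ I.weight
    -- The scalar contributes `v` through homogeneity and `v⁻¹` through the similitude factor.
    linear_combination (-(I.toFun M.val.val) * ((similitude M)⁻¹ ^ I.weight : Aˣ).val) *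
      v.mul_inv

theorem onPSp_mk (M : GSp6 A) : I.onPSp (PSp6.mk M) = I.onGSp M := rfl

theorem onPSp_map (f : A →+* B) (M : PSp6 A) : I.onPSp (PSp6.map f M) = f (I.onPSp M) := by
  obtain ⟨M, rfl⟩ := PSp6.mk_surjective M
  rw [PSp6.map_mk, onPSp_mk, onPSp_mk, onGSp, onGSp, GSp6.map_val, I.map_toFun, similitude_map,
    map_mul, ← map_inv, ← map_pow]
  rfl

theorem onPSp_unipotent_mul {u : PSp6 A} (hu : u ∈ unipotent A) (M : PSp6 A) :
    I.onPSp (u * M) = I.onPSp M := by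
  obtain ⟨M, rfl⟩ := PSp6.mk_surjective M
  obtain ⟨u, hu, rfl⟩ := hu
  rw [← map_mul, onPSp_mk, onPSp_mk, onGSp, onGSp, map_mul, similitude_unipotent hu, one_mul]
  congr 1
  exact I.toFun_unipotent_mul hu _

/-- The order of vanishing of the semi-invariant on `PGL(2, 𝐎) M PSp(6, 𝐎)` is at least `n`. -/
def OrderGE (n : ℤ) (M : PSp6 FF) : Prop :=
  ∀ (k : PGL(2, OO)) (N : PSp6 OO), ∀ j < n,
    (I.onPSp (diagEmb (PGL2.map inclOF k) * M * PSp6.map inclOF N)).coeff j = 0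

variable {I}

theorem OrderGE.mul_right {n : ℤ} {M : PSp6 FF} (h : I.OrderGE n M) (P : PSp6 OO) :
    I.OrderGE n (M * PSp6.map inclOF P) := by
  intro k N j hj
  simpa [mul_assoc] using h k (P * N) j hj

/-- The integral part of `g` merges with `k`, and the unipotent part, conjugated to the far left, is
invisible to the invariant. -/
theorem OrderGE.mul_left {n : ℤ} {M : PSp6 FF} (h : I.OrderGE n M) {g : PSp6 FF}
    (hg : g ∈ orbitGroup) : I.OrderGE n (g * M) := by
  obtain ⟨a, u, hu, rfl⟩ := mem_orbitGroup_iff.1 hg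
  intro k N j hj
  have hconj : diagEmb (PGL2.map inclOF k) * (diagEmb (PGL2.map inclOF a) * u * M) *
      PSp6.map inclOF N = diagEmb (PGL2.map inclOF (k * a)) * u *
        (diagEmb (PGL2.map inclOF (k * a)))⁻¹ *
        (diagEmb (PGL2.map inclOF (k * a)) * M * PSp6.map inclOF N) := by
    simp [mul_assoc]
  rw [hconj, I.onPSp_unipotent_mul (diagEmb_conj_mem_unipotent _ hu), h (k * a) N j hj]

/-- For fixed `k`, `N` and `j` the coefficient is, along a family over `R`, the specialization of a
single element of `R`; hence the condition is an intersection of zero loci. -/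
theorem OrderGE.of_subset_closure {n : ℤ} {l l' : Fin 4 → ℚ} (h : I.OrderGE n (rep l))
    (hc : orbitPSp6 l' ⊆ closure (orbitPSp6 l)) : I.OrderGE n (rep l') := by
  let Z : Set GrPSp6 := {z | ∀ M, GrPSp6.mk M = z → I.OrderGE n M}
  have hZ : ∀ M, GrPSp6.mk M ∈ Z ↔ I.OrderGE n M := by
    refine fun M => ⟨fun hM => hM M rfl, fun hM N hN => ?_⟩
    obtain ⟨P, rfl⟩ := GrPSp6.mk_eq_mk_iff.1 hN
    simpa using hM.mul_right P⁻¹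
  have hclosed : IsClosed Z := by
    rw [isClosed_GrPSp6_iff]
    intro R _ _ _ γ
    let _ := zariskiPoints R
    simp only [hZ, OrderGE, Set.ofPred_forall]
    refine isClosed_iInter fun k => isClosed_iInter fun N => isClosed_iInter fun j =>
      isClosed_iInter fun _ => ?_
    convert isClosed_zariskiPoints_eq_zero ((I.onPSp (PSp6.map (constFF R)
      (diagEmb (PGL2.map inclOF k)) * γ * PSp6.map (constFF R) (PSp6.map inclOF N))).coeff j)
      using 3 with x
    have hx : diagEmb (PGL2.map inclOF k) * PSp6.map (laurentMap x.toRingHom) γ *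
        PSp6.map inclOF N = PSp6.map (laurentMap x.toRingHom) (PSp6.map (constFF R)
          (diagEmb (PGL2.map inclOF k)) * γ * PSp6.map (constFF R) (PSp6.map inclOF N)) := by
      simp [PSp6.laurentMap_constFF]
    rw [hx, I.onPSp_map]
    rfl
  have hsub : orbitPSp6 l ⊆ Z := by
    intro z hz
    obtain ⟨M, rfl⟩ := GrPSp6.mk_surjective z
    obtain ⟨g, hg, P, rfl⟩ := mk_mem_orbitPSp6_iff.1 hz
    exact (hZ _).2 ((h.mul_left hg).mul_right P)
  exact (hZ _).1 (closure_minimal hsub hclosed (hc (MulAction.mem_orbit_self _)))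

variable (I)

/-- The semi-invariant equals `t ^ m` at the representative of an orbit, and all its values on
`PGL(2, 𝐎) (rep l) PSp(6, 𝐎)` are divisible by `t ^ m`. -/
def HasOrder (l : Fin 4 → ℚ) (m : ℤ) : Prop :=
  ∃ o : GL (Fin 2) OO → GSp6 OO → OO, o 1 1 = 1 ∧ ∀ k N,
    I.onPSp (diagEmb (PGL2.map inclOF (Matrix.ProjGenLinGroup.mk k)) * rep l *
      PSp6.map inclOF (PSp6.mk N)) = (tUnit ^ m : FFˣ).val * inclOF (o k N)

variable {I}

theorem HasOrder.orderGE {l : Fin 4 → ℚ} {m : ℤ} (h : I.HasOrder l m) :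
    I.OrderGE m (rep l) := by
  obtain ⟨o, -, ho⟩ := h
  intro k N j hj
  obtain ⟨k, rfl⟩ := Matrix.ProjGenLinGroup.mk_surjective k
  obtain ⟨N, rfl⟩ := PSp6.mk_surjective N
  rw [ho, coeff_tUnit_zpow_mul_inclOF, coeff_inclOF_of_neg _ (by omega)]

/-- At `k = 1`, `N = 1` the cofactor is `1`, so the order `m` is attained. -/
theorem HasOrder.le_of_orderGE {l : Fin 4 → ℚ} {m n : ℤ} (h : I.HasOrder l m)
    (hn : I.OrderGE n (rep l)) : n ≤ m := by
  obtain ⟨o, h1, ho⟩ := h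
  by_contra! hlt
  have h2 := hn (Matrix.ProjGenLinGroup.mk 1) (PSp6.mk 1) m hlt
  rw [ho, h1, map_one, mul_one, tUnit_zpow, HahnSeries.coeff_single_same] at h2
  exact one_ne_zero h2

theorem HasOrder.le {l l' : Fin 4 → ℚ} {m m' : ℤ} (h : I.HasOrder l m) (h' : I.HasOrder l' m')
    (hc : orbitPSp6 l' ⊆ closure (orbitPSp6 l)) : m ≤ m' :=
  h'.le_of_orderGE (h.orderGE.of_subset_closure hc)

/-- Reduces an order on `PSp6` to a matrix identity: dividing by the similitude factor shifts the
exponent `r` by `-q * I.weight`, while the determinant of `k` and the similitude of `N` contribute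
only units of `𝐎`. -/
theorem HasOrder.of_lift {l : Fin 4 → ℚ} {R : GSp6 FF} (hR : rep l = PSp6.mk R) {q r m : ℤ}
    (hq : similitude R = tUnit ^ q) (hm : m = r - q * I.weight)
    (o : Matrix (Fin 2) (Fin 2) OO → Matrix (Fin 6) (Fin 6) OO → OO) (h1 : o 1 1 = 1)
    (ho : ∀ k N, I.toFun (diagEmbMatrix (k.map inclOF) * (R.val.val * N.map inclOF)) =
      (tUnit ^ r : FFˣ).val * inclOF (o k N)) : I.HasOrder l m := by
  refine ⟨fun k N => o k.val N.val.val * (((Matrix.GeneralLinearGroup.det k)⁻¹ *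
    (similitude N)⁻¹) ^ I.weight : OOˣ).val, by simp [h1], fun k N => ?_⟩
  rw [hR, PGL2.map_mk, diagEmb_mk, PSp6.map_mk, ← map_mul, ← map_mul, onPSp_mk, onGSp, map_mul,
    map_mul, hq, diagEmbGL_map, similitude_map, similitude_map, similitude_diagEmbGL, mul_assoc]
  have h2 := ho k.val N.val.val
  rw [diagEmbMatrix_map] at h2
  erw [h2]
  have h3 : ((Units.map inclOF.toMonoidHom (Matrix.GeneralLinearGroup.det k) * tUnit ^ q *
      Units.map inclOF.toMonoidHom (similitude N))⁻¹ ^ I.weight) =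
      tUnit ^ (-(q * I.weight)) * Units.map inclOF.toMonoidHom
        (((Matrix.GeneralLinearGroup.det k)⁻¹ * (similitude N)⁻¹) ^ I.weight) := by
    rw [zpow_neg, zpow_mul, zpow_natCast, map_pow, map_mul, map_inv, map_inv]
    exact mul_mul_inv_pow (G := FFˣ) _ _ _ _
  rw [h3, hm, sub_eq_add_neg, zpow_add, Units.val_mul, Units.val_mul, map_mul]
  change _ = _ * (_ * (Units.map inclOF.toMonoidHom _).val)
  ring

end SemiInvariant

/-! ### The four semi-invariants -/

section Rows

variable {A B : Type*} [CommRing A] [CommRing B]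

theorem unipotent_mul_apply_two {u : GSp6 A} (hu : u ∈ unipotentGSp A)
    (M : Matrix (Fin 6) (Fin 6) A) (j : Fin 6) :
    (u.val.val * M) 2 j = M 2 j + u.val.val 2 4 * M 4 j + u.val.val 2 5 * M 5 j := by
  simp [Matrix.mul_apply, Fin.sum_univ_six, unipotent_apply_self hu,
    unipotent_apply_of_ne hu (i := 2) (j := 0) (by decide) (by decide),
    unipotent_apply_of_ne hu (i := 2) (j := 1) (by decide) (by decide),
    unipotent_apply_of_ne hu (i := 2) (j := 3) (by decide) (by decide)]

theorem unipotent_mul_apply_three {u : GSp6 A} (hu : u ∈ unipotentGSp A)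
    (M : Matrix (Fin 6) (Fin 6) A) (j : Fin 6) :
    (u.val.val * M) 3 j = M 3 j + u.val.val 3 4 * M 4 j + u.val.val 3 5 * M 5 j := by
  simp [Matrix.mul_apply, Fin.sum_univ_six, unipotent_apply_self hu,
    unipotent_apply_of_ne hu (i := 3) (j := 0) (by decide) (by decide),
    unipotent_apply_of_ne hu (i := 3) (j := 1) (by decide) (by decide),
    unipotent_apply_of_ne hu (i := 3) (j := 2) (by decide) (by decide)]

theorem unipotent_mul_apply_four {u : GSp6 A} (hu : u ∈ unipotentGSp A)
    (M : Matrix (Fin 6) (Fin 6) A) (j : Fin 6) : (u.val.val * M) 4 j = M 4 j := by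
  simp [Matrix.mul_apply, Fin.sum_univ_six, unipotent_apply_self hu,
    unipotent_apply_of_ne hu (i := 4) (j := 0) (by decide) (by decide),
    unipotent_apply_of_ne hu (i := 4) (j := 1) (by decide) (by decide),
    unipotent_apply_of_ne hu (i := 4) (j := 2) (by decide) (by decide),
    unipotent_apply_of_ne hu (i := 4) (j := 3) (by decide) (by decide),
    unipotent_apply_of_ne hu (i := 4) (j := 5) (by decide) (by decide)]

theorem unipotent_mul_apply_five {u : GSp6 A} (hu : u ∈ unipotentGSp A)
    (M : Matrix (Fin 6) (Fin 6) A) (j : Fin 6) : (u.val.val * M) 5 j = M 5 j := by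
  simp [Matrix.mul_apply, Fin.sum_univ_six, unipotent_apply_self hu,
    unipotent_apply_of_ne hu (i := 5) (j := 0) (by decide) (by decide),
    unipotent_apply_of_ne hu (i := 5) (j := 1) (by decide) (by decide),
    unipotent_apply_of_ne hu (i := 5) (j := 2) (by decide) (by decide),
    unipotent_apply_of_ne hu (i := 5) (j := 3) (by decide) (by decide),
    unipotent_apply_of_ne hu (i := 5) (j := 4) (by decide) (by decide)]

theorem diagEmbMatrix_mul_apply_two (a : Matrix (Fin 2) (Fin 2) A)
    (M : Matrix (Fin 6) (Fin 6) A) (j : Fin 6) :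
    (diagEmbMatrix a * M) 2 j = a 0 0 * M 2 j + a 0 1 * M 3 j := by
  simp [Matrix.mul_apply, Fin.sum_univ_six, diagEmbMatrix]

theorem diagEmbMatrix_mul_apply_three (a : Matrix (Fin 2) (Fin 2) A)
    (M : Matrix (Fin 6) (Fin 6) A) (j : Fin 6) :
    (diagEmbMatrix a * M) 3 j = a 1 0 * M 2 j + a 1 1 * M 3 j := by
  simp [Matrix.mul_apply, Fin.sum_univ_six, diagEmbMatrix]

theorem diagEmbMatrix_mul_apply_four (a : Matrix (Fin 2) (Fin 2) A)
    (M : Matrix (Fin 6) (Fin 6) A) (j : Fin 6) :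
    (diagEmbMatrix a * M) 4 j = a 0 0 * M 4 j - a 0 1 * M 5 j := by
  simp [Matrix.mul_apply, Fin.sum_univ_six, diagEmbMatrix, sub_eq_add_neg]

theorem diagEmbMatrix_mul_apply_five (a : Matrix (Fin 2) (Fin 2) A)
    (M : Matrix (Fin 6) (Fin 6) A) (j : Fin 6) :
    (diagEmbMatrix a * M) 5 j = -a 1 0 * M 4 j + a 1 1 * M 5 j := by
  simp [Matrix.mul_apply, Fin.sum_univ_six, diagEmbMatrix]

/-- The minor with rows `5, 6` and columns `5, 6`. -/
def cornerMinor (M : Matrix (Fin 6) (Fin 6) A) : A := M 4 4 * M 5 5 - M 4 5 * M 5 4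

/-- The determinant of the matrix whose first row consists of the last three entries of `v`, and
whose other rows are taken from the rows `5, 6` and columns `4, 5, 6` of `M`. -/
def bottomMinor (v : Fin 6 → A) (M : Matrix (Fin 6) (Fin 6) A) : A :=
  v 3 * (M 4 4 * M 5 5 - M 4 5 * M 5 4) - v 4 * (M 4 3 * M 5 5 - M 4 5 * M 5 3) +
    v 5 * (M 4 3 * M 5 4 - M 4 4 * M 5 3)

theorem map_cornerMinor (f : A →+* B) (M : Matrix (Fin 6) (Fin 6) A) :
    f (cornerMinor M) = cornerMinor (M.map f) := by
  simp [cornerMinor]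

theorem map_bottomMinor (f : A →+* B) (v : Fin 6 → A) (M : Matrix (Fin 6) (Fin 6) A) :
    f (bottomMinor v M) = bottomMinor (fun j => f (v j)) (M.map f) := by
  simp [bottomMinor]

end Rows

/-- The square of the last entry. -/
def entryInvariant : SemiInvariant where
  weight := 1
  toFun M := M 5 5 ^ 2
  map_toFun f M := by simp
  toFun_smul c M := by simp; ring
  toFun_unipotent_mul hu M := by rw [unipotent_mul_apply_five hu]

/-- The minor with rows and columns `5, 6`. -/
def cornerMinorInvariant : SemiInvariant where
  weight := 1
  toFun M := cornerMinor M
  map_toFun f M := (map_cornerMinor f M).symm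
  toFun_smul c M := by simp [cornerMinor]; ring
  toFun_unipotent_mul hu M := by
    simp only [cornerMinor, unipotent_mul_apply_five hu, unipotent_mul_apply_four hu]

/-- The square of the minor with rows and columns `4, 5, 6`. -/
def bottomMinorInvariant : SemiInvariant where
  weight := 3
  toFun M := bottomMinor (M 3) M ^ 2
  map_toFun f M := by rw [map_pow, map_bottomMinor]; rfl
  toFun_smul c M := by simp [bottomMinor]; ring
  toFun_unipotent_mul hu M := by
    simp only [bottomMinor, unipotent_mul_apply_five hu, unipotent_mul_apply_four hu,
      unipotent_mul_apply_three hu]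
    ring

/-- The contraction of the minors with rows `3, 5, 6` and `4, 5, 6` with the last two rows, by
means of the `SL(2)`-invariant pairing. -/
def pairingInvariant : SemiInvariant where
  weight := 2
  toFun M := bottomMinor (M 2) M * M 5 5 + bottomMinor (M 3) M * M 4 5
  map_toFun f M := by simp only [map_add, map_mul, map_bottomMinor]; rfl
  toFun_smul c M := by simp [bottomMinor]; ring
  toFun_unipotent_mul hu M := by
    simp only [bottomMinor, unipotent_mul_apply_five hu, unipotent_mul_apply_four hu,
      unipotent_mul_apply_three hu, unipotent_mul_apply_two hu]
    ring

/-! ### Values at the representatives of the orbits -/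

theorem similitude_torusGSp {A : Type*} [CommRing A] (x y z c : Aˣ) :
    similitude (torusGSp x y z c) = c := by
  apply similitude_eq
  ext i j
  fin_cases i <;> fin_cases j <;>
    simp [torusGSp, gram, div_eq_mul_inv, mul_comm, ← Units.val_mul]

theorem exists_gElt_lift (A : Type*) [CommRing A] : ∃ g : GSp6 A, gElt A = PSp6.mk g ∧
    g.val.val = Matrix.transvection 2 3 1 ∧ similitude g = 1 := by
  refine ⟨⟨transvectionGL 1, _⟩, rfl, rfl, similitude_eq ?_⟩
  ext i j
  fin_cases i <;> fin_cases j <;>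
    simp [transvectionGL, Matrix.transvection, Matrix.single, gram, Matrix.mul_apply,
      Fin.sum_univ_six, Matrix.one_apply]

theorem diagEmbMatrix_mul_transvection_mul_diagonal {A : Type*} [CommRing A] (w : Fin 2 → A)
    (v : Fin 6 → A) (N : Matrix (Fin 6) (Fin 6) A) (j : Fin 6) :
    (diagEmbMatrix (Matrix.diagonal w) * Matrix.transvection (2 : Fin 6) 3 (1 : A) *
        Matrix.diagonal v * N) 2 j =
        w 0 * (v 2 * N 2 j + v 3 * N 3 j) ∧
      (diagEmbMatrix (Matrix.diagonal w) * Matrix.transvection (2 : Fin 6) 3 (1 : A) *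
        Matrix.diagonal v * N) 3 j =
        w 1 * (v 3 * N 3 j) ∧
      (diagEmbMatrix (Matrix.diagonal w) * Matrix.transvection (2 : Fin 6) 3 (1 : A) *
        Matrix.diagonal v * N) 4 j =
        w 0 * (v 4 * N 4 j) ∧
      (diagEmbMatrix (Matrix.diagonal w) * Matrix.transvection (2 : Fin 6) 3 (1 : A) *
        Matrix.diagonal v * N) 5 j =
        w 1 * (v 5 * N 5 j) := by
  have htr : ∀ (M : Matrix (Fin 6) (Fin 6) A) (i : Fin 6), i ≠ 2 →
      (Matrix.transvection (2 : Fin 6) 3 (1 : A) * M) i j = M i j := fun M i hi =>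
    Matrix.transvection_mul_apply_of_ne _ _ _ _ hi _ M
  have htr2 : ∀ M : Matrix (Fin 6) (Fin 6) A,
      (Matrix.transvection (2 : Fin 6) 3 (1 : A) * M) 2 j = M 2 j + M 3 j := fun M => by
    rw [Matrix.transvection_mul_apply_same, one_mul]
  simp only [Matrix.mul_assoc, diagEmbMatrix_mul_apply_two, diagEmbMatrix_mul_apply_three,
    diagEmbMatrix_mul_apply_four, diagEmbMatrix_mul_apply_five, htr2, htr _ 3 (by decide),
    htr _ 4 (by decide), htr _ 5 (by decide), Matrix.diagonal_mul, Matrix.diagonal_apply_eq,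
    Matrix.diagonal_apply_ne _ (show (0 : Fin 2) ≠ 1 by decide),
    Matrix.diagonal_apply_ne _ (show (1 : Fin 2) ≠ 0 by decide)]
  simp

theorem inclOF_X_pow (n : ℕ) : inclOF (PowerSeries.X ^ n) = (tUnit ^ (n : ℤ) : FFˣ).val := by
  rw [tUnit_zpow, inclOF, HahnSeries.ofPowerSeries_X_pow]

/-- A lift of the representative of an orbit to `GSp(6, 𝐅)`, with its last four rows. -/
theorem exists_rep_lift {l : Fin 4 → ℚ} (hl : IsRelevant l) :
    ∃ (n e : ℤ) (b c d : ℕ), (n : ℚ) = 2 * l 0 ∧ (e : ℚ) = l 0 - l 2 ∧ (b : ℚ) = l 0 - l 1 ∧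
      (c : ℚ) = 2 * l 2 ∧ (d : ℚ) = 2 * l 3 ∧ ∃ R : GSp6 FF, rep l = PSp6.mk R ∧
      similitude R = tUnit ^ (d + n) ∧ ∀ (N : Matrix (Fin 6) (Fin 6) FF) (j : Fin 6),
        (R.val.val * N) 2 j = inclOF (PowerSeries.X ^ d) * (tUnit ^ e : FFˣ).val *
          (inclOF (PowerSeries.X ^ c) * N 2 j + N 3 j) ∧
        (R.val.val * N) 3 j = (tUnit ^ e : FFˣ).val * N 3 j ∧
        (R.val.val * N) 4 j = inclOF (PowerSeries.X ^ d) * inclOF (PowerSeries.X ^ b) * N 4 j ∧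
        (R.val.val * N) 5 j = N 5 j := by
  obtain ⟨⟨hhalf, ⟨b, hb⟩, ⟨f, hf⟩⟩, hb0, hc0, hd0⟩ := hl
  obtain ⟨n, hn⟩ := hhalf 0
  obtain ⟨c, hc⟩ := hhalf 2
  obtain ⟨d, hd⟩ := hhalf 3
  have hb' : 0 ≤ b := by exact_mod_cast hb ▸ hb0
  have hc' : 0 ≤ c := by
    have : (0 : ℚ) ≤ c := by linarith
    exact_mod_cast this
  have hd' : 0 ≤ d := by
    have : (0 : ℚ) ≤ d := by linarith
    exact_mod_cast this
  lift b to ℕ using hb'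
  lift c to ℕ using hc'
  lift d to ℕ using hd'
  push_cast at hb hc hd
  have hA : ⌊2 * l 0⌋ = n := by rw [hn, Int.floor_intCast]
  have hB : ⌊l 0 + l 1⌋ = n - b := by
    rw [show l 0 + l 1 = ((n - b : ℤ) : ℚ) by push_cast; linarith, Int.floor_intCast]
  have hC : ⌊l 0 + l 2⌋ = b + f + c := by
    rw [show l 0 + l 2 = ((b + f + c : ℤ) : ℚ) by push_cast; linarith, Int.floor_intCast]
  have hD : ⌊2 * l 3⌋ = d := by rw [hd, Int.floor_natCast]
  have hnc : n = 2 * (b + f) + c := by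
    have : (n : ℚ) = 2 * (b + f) + c := by linarith
    exact_mod_cast this
  -- Relevance is exactly what lets `b`, `c`, `d` be natural numbers, so that their powers of `t`
  -- are power series; `e = b + f` may be negative.
  refine ⟨n, b + f, b, c, d, hn.symm, by push_cast; linarith, hb.symm, hc.symm, hd.symm, ?_⟩
  let D : GL (Fin 2) FF :=
    { val := Matrix.diagonal fun i => (![tUnit ^ ⌊2 * l 3⌋, 1] i : FFˣ).val
      inv := Matrix.diagonal fun i => ((![tUnit ^ ⌊2 * l 3⌋, 1] i)⁻¹ : FFˣ).val
      val_inv := by simp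
      inv_val := by simp }
  let S : GSp6 FF := torusGSp (tUnit ^ ⌊2 * l 0⌋) (tUnit ^ ⌊l 0 + l 1⌋) (tUnit ^ ⌊l 0 + l 2⌋)
    (tUnit ^ ⌊2 * l 0⌋)
  obtain ⟨g, hg, hgM, hgs⟩ := exists_gElt_lift FF
  refine ⟨diagEmbGL D * g * S, ?_, ?_, ?_⟩
  · rw [rep, hg]
    rfl
  · have hDet : Matrix.GeneralLinearGroup.det D = tUnit ^ ⌊2 * l 3⌋ := by
      ext1
      simp [D]
    rw [map_mul, map_mul, similitude_diagEmbGL, hgs, similitude_torusGSp, hDet, mul_one, hA, hD,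
      zpow_add]
  · intro N j
    have hval : (diagEmbGL D * g * S).val.val = diagEmbMatrix D.val * g.val.val * S.val.val := rfl
    have hS3 : tUnit ^ ⌊2 * l 0⌋ / tUnit ^ ⌊l 0 + l 2⌋ = tUnit ^ (b + f) := by
      rw [div_eq_mul_inv, ← zpow_sub, hA, hC]
      congr 1
      omega
    have hS4 : tUnit ^ ⌊2 * l 0⌋ / tUnit ^ ⌊l 0 + l 1⌋ = tUnit ^ (b : ℤ) := by
      rw [div_eq_mul_inv, ← zpow_sub, hA, hB]
      congr 1
      omega
    have hS2 : tUnit ^ ⌊l 0 + l 2⌋ = tUnit ^ (b + f) * tUnit ^ (c : ℤ) := by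
      rw [← zpow_add, hC]
    obtain ⟨h2, h3, h4, h5⟩ := diagEmbMatrix_mul_transvection_mul_diagonal
      (fun i => (![tUnit ^ ⌊2 * l 3⌋, 1] i : FFˣ).val)
      (fun i => (![tUnit ^ ⌊2 * l 0⌋, tUnit ^ ⌊l 0 + l 1⌋, tUnit ^ ⌊l 0 + l 2⌋,
        tUnit ^ ⌊2 * l 0⌋ / tUnit ^ ⌊l 0 + l 2⌋, tUnit ^ ⌊2 * l 0⌋ / tUnit ^ ⌊l 0 + l 1⌋,
        tUnit ^ ⌊2 * l 0⌋ / tUnit ^ ⌊2 * l 0⌋] i : FFˣ).val) N j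
    rw [hval, hgM, inclOF_X_pow, inclOF_X_pow, inclOF_X_pow, ← hD]
    refine ⟨h2.trans ?_, h3.trans ?_, h4.trans ?_, h5.trans ?_⟩
    · change (tUnit ^ ⌊2 * l 3⌋).val * ((tUnit ^ ⌊l 0 + l 2⌋).val * _ +
        (tUnit ^ ⌊2 * l 0⌋ / tUnit ^ ⌊l 0 + l 2⌋).val * _) = _
      rw [hS3, hS2, Units.val_mul, mul_assoc, mul_assoc, ← mul_add]
    · change (1 : FFˣ).val * ((tUnit ^ ⌊2 * l 0⌋ / tUnit ^ ⌊l 0 + l 2⌋).val * _) = _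
      rw [hS3, Units.val_one, one_mul]
    · change (tUnit ^ ⌊2 * l 3⌋).val *
        ((tUnit ^ ⌊2 * l 0⌋ / tUnit ^ ⌊l 0 + l 1⌋).val * _) = _
      rw [hS4, mul_assoc]
    · change (1 : FFˣ).val * ((tUnit ^ ⌊2 * l 0⌋ / tUnit ^ ⌊2 * l 0⌋).val * _) = _
      rw [div_self', Units.val_one, one_mul, one_mul]

/-! ### Minimal orders of the four semi-invariants -/

theorem hasOrder_entryInvariant {l : Fin 4 → ℚ} (hl : IsRelevant l) :
    ∃ m : ℤ, (m : ℚ) = -2 * (l 0 + l 3) ∧ entryInvariant.HasOrder l m := by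
  obtain ⟨n, e, b, c, d, hn, he, hb, hc, hd, R, hR, hq, hrow⟩ := exists_rep_lift hl
  -- The last row of the lift carries no power of `t`, and the admixture of row 5 carries `t ^ (d +
  -- b)` with `d + b ≥ 0`; hence `r = 0`.
  refine ⟨_, ?_, .of_lift hR hq (r := 0) rfl (fun k N => (-k 1 0 * (PowerSeries.X ^ d *
    PowerSeries.X ^ b * N 4 5) + k 1 1 * N 5 5) ^ 2) (by simp) fun k N => ?_⟩
  · simp [entryInvariant]
    linarith
  · simp only [entryInvariant, diagEmbMatrix_mul_apply_five, hrow, pow_two, map_neg, map_add,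
      map_mul, Matrix.map_apply, zpow_zero, Units.val_one]
    ring

theorem hasOrder_cornerMinorInvariant {l : Fin 4 → ℚ} (hl : IsRelevant l) :
    ∃ m : ℤ, (m : ℚ) = -(l 0 + l 1) ∧ cornerMinorInvariant.HasOrder l m := by
  obtain ⟨n, e, b, c, d, hn, he, hb, hc, hd, R, hR, hq, hrow⟩ := exists_rep_lift hl
  refine ⟨_, ?_, .of_lift hR hq (r := d + b) rfl (fun k N => k.det * cornerMinor N)
    (by simp [cornerMinor]) fun k N => ?_⟩
  · simp [cornerMinorInvariant]
    linarith
  · rw [zpow_add, Units.val_mul, ← inclOF_X_pow, ← inclOF_X_pow, map_mul, map_cornerMinor,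
      Matrix.det_fin_two]
    simp only [cornerMinorInvariant, cornerMinor, diagEmbMatrix_mul_apply_four,
      diagEmbMatrix_mul_apply_five, hrow, map_sub, map_mul, Matrix.map_apply]
    ring

theorem hasOrder_bottomMinorInvariant {l : Fin 4 → ℚ} (hl : IsRelevant l) :
    ∃ m : ℤ, (m : ℚ) = -2 * (l 0 + l 1 + l 2 + l 3) ∧ bottomMinorInvariant.HasOrder l m := by
  obtain ⟨n, e, b, c, d, hn, he, hb, hc, hd, R, hR, hq, hrow⟩ := exists_rep_lift hl
  -- Row 4 contributes `t ^ e` even after mixing with row 3, and rows 5, 6 contribute `t ^ (d + b)`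
  -- times the determinant of `k`; everything is doubled by the square.
  refine ⟨_, ?_, .of_lift hR hq (r := d + b + e + (d + b + e)) rfl
    (fun k N => (k 0 0 * k 1 1 - k 0 1 * k 1 0) * (k 0 0 * k 1 1 - k 0 1 * k 1 0) *
      (bottomMinor (fun j => k 1 0 * PowerSeries.X ^ d *
        (PowerSeries.X ^ c * N 2 j + N 3 j) + k 1 1 * N 3 j) N *
      bottomMinor (fun j => k 1 0 * PowerSeries.X ^ d *
        (PowerSeries.X ^ c * N 2 j + N 3 j) + k 1 1 * N 3 j) N))
    (by simp [bottomMinor]) fun k N => ?_⟩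
  · simp [bottomMinorInvariant]
    linarith
  · rw [zpow_add, zpow_add, zpow_add, Units.val_mul, Units.val_mul, Units.val_mul,
      ← inclOF_X_pow, ← inclOF_X_pow]
    simp only [bottomMinorInvariant, bottomMinor, diagEmbMatrix_mul_apply_three,
      diagEmbMatrix_mul_apply_four, diagEmbMatrix_mul_apply_five, hrow, map_sub, map_add, map_mul,
      Matrix.map_apply]
    ring

theorem hasOrder_pairingInvariant {l : Fin 4 → ℚ} (hl : IsRelevant l) :
    ∃ m : ℤ, (m : ℚ) = -(2 * l 0 + l 1 + l 2) ∧ pairingInvariant.HasOrder l m := by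
  obtain ⟨n, e, b, c, d, hn, he, hb, hc, hd, R, hR, hq, hrow⟩ := exists_rep_lift hl
  -- The pairing is multiplied by the square of the determinant of `k`. Its two terms carry `t ^ (2d
  -- + b + e)` and `t ^ (2d + 2b + e)`. The value `1` at the identity comes from the summand `N 3
  -- j`, that is, from the entry `E₃₄` of `gElt`; without it the invariant would vanish at the
  -- representative.
  refine ⟨_, ?_, .of_lift hR hq (r := d + d + b + e) rfl
    (fun k N => (k 0 0 * k 1 1 - k 0 1 * k 1 0) * (k 0 0 * k 1 1 - k 0 1 * k 1 0) *
      (bottomMinor (fun j => PowerSeries.X ^ c * N 2 j + N 3 j) N * N 5 5 +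
        PowerSeries.X ^ b * bottomMinor (N 3) N * N 4 5))
    (by simp [bottomMinor]) fun k N => ?_⟩
  · simp [pairingInvariant]
    linarith
  · rw [zpow_add, zpow_add, zpow_add, Units.val_mul, Units.val_mul, Units.val_mul,
      ← inclOF_X_pow, ← inclOF_X_pow]
    simp only [pairingInvariant, bottomMinor, diagEmbMatrix_mul_apply_two,
      diagEmbMatrix_mul_apply_three, diagEmbMatrix_mul_apply_four, diagEmbMatrix_mul_apply_five,
      hrow, map_sub, map_add, map_mul, Matrix.map_apply]
    ring

/-! ### The connected component -/

theorem order_units_inv (f : FFˣ) :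
    HahnSeries.order (f⁻¹ : FFˣ).val = -HahnSeries.order f.val := by
  have h := HahnSeries.order_mul f.ne_zero (f⁻¹).ne_zero
  rw [f.mul_inv, HahnSeries.order_one] at h
  omega

/-- Orders of `f` and `f⁻¹` add up to zero, so lower bounds on both pin the order down. This turns
equality of orders into vanishing of coefficients, a closed condition. -/
theorem order_eq_iff_coeff_eq_zero (f : FFˣ) (n : ℤ) :
    HahnSeries.order f.val = n ↔
      (∀ j < n, f.val.coeff j = 0) ∧ ∀ j < -n, (f⁻¹ : FFˣ).val.coeff j = 0 := by
  constructor
  · rintro rfl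
    refine ⟨fun j hj => HahnSeries.coeff_eq_zero_of_lt_order hj, fun j hj => ?_⟩
    exact HahnSeries.coeff_eq_zero_of_lt_order (by rwa [order_units_inv])
  · rintro ⟨h1, h2⟩
    have a1 : n ≤ HahnSeries.order f.val := by
      by_contra! h
      exact (mt HahnSeries.coeff_order_eq_zero.1 f.ne_zero) (h1 _ h)
    have a2 : -n ≤ HahnSeries.order (f⁻¹ : FFˣ).val := by
      by_contra! h
      exact (mt HahnSeries.coeff_order_eq_zero.1 (f⁻¹).ne_zero) (h2 _ h)
    rw [order_units_inv] at a2
    omega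

theorem isClosed_order_emod_two_eq {R : Type} [CommRing R] [Algebra ℂ R] (f : (LaurentSeries R)ˣ)
    (e : ℤ) : IsClosed[zariskiPoints R] {x : R →ₐ[ℂ] ℂ |
      HahnSeries.order (Units.map (laurentMap x.toRingHom).toMonoidHom f).val % 2 = e} := by
  let _ := zariskiPoints R
  have hclosed : ∀ n : ℤ, IsClosed {x : R →ₐ[ℂ] ℂ |
      HahnSeries.order (Units.map (laurentMap x.toRingHom).toMonoidHom f).val = n} := by
    intro n
    simp only [order_eq_iff_coeff_eq_zero, Set.ofPred_and, Set.ofPred_forall]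
    refine (isClosed_iInter fun j => isClosed_iInter fun _ => ?_).inter
      (isClosed_iInter fun j => isClosed_iInter fun _ => ?_)
    · exact isClosed_zariskiPoints_eq_zero (f.val.coeff j)
    · exact isClosed_zariskiPoints_eq_zero ((f⁻¹ : (LaurentSeries R)ˣ).val.coeff j)
  -- Specialization cannot lower the order of `f` or of `f⁻¹` below its value over `R`, so only
  -- finitely many orders occur and the union of closed level sets is finite.
  have hfin : {n : ℤ | n % 2 = e ∧ HahnSeries.order f.val ≤ n ∧
      n ≤ -HahnSeries.order (f⁻¹ : (LaurentSeries R)ˣ).val}.Finite :=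
    (Set.finite_Icc _ _).subset fun n hn => hn.2
  convert hfin.isClosed_biUnion fun n _ => hclosed n using 1
  ext x
  simp only [Set.mem_iUnion, exists_prop, Set.mem_ofPred_eq]
  refine ⟨fun hx => ⟨_, ⟨hx, ?_, ?_⟩, rfl⟩, ?_⟩
  · by_contra! h
    exact (mt HahnSeries.coeff_order_eq_zero.1
      (Units.map (laurentMap x.toRingHom).toMonoidHom f).ne_zero) ((congrArg x (HahnSeries.coeff_eq_zero_of_lt_order h)).trans
        (map_zero x))
  · by_contra! h
    have h' : HahnSeries.order (Units.map (laurentMap x.toRingHom).toMonoidHom f)⁻¹.val <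
        HahnSeries.order (f⁻¹ : (LaurentSeries R)ˣ).val := by
      rw [order_units_inv]
      omega
    exact (mt HahnSeries.coeff_order_eq_zero.1
      (Units.map (laurentMap x.toRingHom).toMonoidHom f)⁻¹.ne_zero) ((congrArg x (HahnSeries.coeff_eq_zero_of_lt_order h')).trans
        (map_zero x))
  · rintro ⟨n, hn, rfl⟩
    exact hn.1

/-! ### Parity of the similitude factor -/

theorem order_map_inclOF (u : OOˣ) :
    HahnSeries.order (Units.map inclOF.toMonoidHom u).val = 0 := by
  rw [order_eq_iff_coeff_eq_zero]
  refine ⟨fun j hj => coeff_inclOF_of_neg _ hj, fun j hj => ?_⟩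
  rw [← map_inv]
  exact coeff_inclOF_of_neg _ (by simpa using hj)

theorem order_units_mul (f g : FFˣ) :
    HahnSeries.order (f * g).val = HahnSeries.order f.val + HahnSeries.order g.val :=
  HahnSeries.order_mul f.ne_zero g.ne_zero

/-- The similitude factor of an element of `PSp(6, 𝐅)` has order congruent to `e` modulo `2`. -/
def HasParity (e : ℤ) (M : PSp6 FF) : Prop :=
  ∀ G : GSp6 FF, PSp6.mk G = M → HahnSeries.order (similitude G).val % 2 = e

/-- A scalar `u` changes the similitude factor by `u * u`, hence its order by an even number. -/
theorem hasParity_mk {e : ℤ} {G : GSp6 FF} :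
    HasParity e (PSp6.mk G) ↔ HahnSeries.order (similitude G).val % 2 = e := by
  refine ⟨fun h => h G rfl, fun h G' hG' => ?_⟩
  obtain ⟨u, rfl⟩ := PSp6.mk_eq_mk_iff.1 hG'.symm
  rw [map_mul, similitude_scalar, order_units_mul, order_units_mul]
  omega

theorem HasParity.mul_right {e : ℤ} {M : PSp6 FF} (h : HasParity e M) (P : PSp6 OO) :
    HasParity e (M * PSp6.map inclOF P) := by
  obtain ⟨G, rfl⟩ := PSp6.mk_surjective M
  obtain ⟨P, rfl⟩ := PSp6.mk_surjective P
  rw [PSp6.map_mk, ← map_mul, hasParity_mk, map_mul, similitude_map, order_units_mul,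
    order_map_inclOF, add_zero]
  exact hasParity_mk.1 h

theorem HasParity.mul_left {e : ℤ} {M : PSp6 FF} (h : HasParity e M) {g : PSp6 FF}
    (hg : g ∈ orbitGroup) : HasParity e (g * M) := by
  obtain ⟨G, rfl⟩ := PSp6.mk_surjective M
  obtain ⟨k, u, ⟨u, hu, rfl⟩, rfl⟩ := mem_orbitGroup_iff.1 hg
  obtain ⟨k, rfl⟩ := Matrix.ProjGenLinGroup.mk_surjective k
  rw [PGL2.map_mk, diagEmb_mk, ← map_mul, ← map_mul, hasParity_mk, map_mul, map_mul,
    similitude_unipotent hu, mul_one, diagEmbGL_map, similitude_map, order_units_mul,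
    order_map_inclOF, zero_add]
  exact hasParity_mk.1 h

theorem HasParity.of_subset_closure {e : ℤ} {l l' : Fin 4 → ℚ} (h : HasParity e (rep l))
    (hc : orbitPSp6 l' ⊆ closure (orbitPSp6 l)) : HasParity e (rep l') := by
  let Z : Set GrPSp6 := {z | ∀ M, GrPSp6.mk M = z → HasParity e M}
  have hZ : ∀ M, GrPSp6.mk M ∈ Z ↔ HasParity e M := by
    refine fun M => ⟨fun hM => hM M rfl, fun hM N hN => ?_⟩
    obtain ⟨P, rfl⟩ := GrPSp6.mk_eq_mk_iff.1 hN
    simpa using hM.mul_right P⁻¹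
  have hclosed : IsClosed Z := by
    rw [isClosed_GrPSp6_iff]
    intro R _ _ _ γ
    obtain ⟨γ, rfl⟩ := PSp6.mk_surjective γ
    simp only [hZ, PSp6.map_mk, hasParity_mk, similitude_map]
    exact isClosed_order_emod_two_eq (similitude γ) e
  have hsub : orbitPSp6 l ⊆ Z := by
    intro z hz
    obtain ⟨M, rfl⟩ := GrPSp6.mk_surjective z
    obtain ⟨g, hg, P, rfl⟩ := mk_mem_orbitPSp6_iff.1 hz
    exact (hZ _).2 ((h.mul_left hg).mul_right P)
  exact (hZ _).1 (closure_minimal hsub hclosed (hc (MulAction.mem_orbit_self _)))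

theorem hasParity_rep {l : Fin 4 → ℚ} (hl : IsRelevant l) :
    ∃ m : ℤ, (m : ℚ) = 2 * (l 0 + l 3) ∧ HasParity (m % 2) (rep l) := by
  obtain ⟨n, e, b, c, d, hn, he, hb, hc, hd, R, hR, hq, -⟩ := exists_rep_lift hl
  refine ⟨d + n, by push_cast; linarith, ?_⟩
  rw [hR, hasParity_mk, hq, tUnit_zpow, HahnSeries.order_single one_ne_zero]

theorem HasParity.unique {e e' : ℤ} {M : PSp6 FF} (h : HasParity e M) (h' : HasParity e' M) :
    e = e' := by
  obtain ⟨G, rfl⟩ := PSp6.mk_surjective M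
  exact (h G rfl).symm.trans (h' G rfl)

/-! ### The order on the weights -/

theorem exists_sum_simpleRoot {l l' : Fin 4 → ℚ} (hl : IsRelevant l) (hl' : IsRelevant l')
    (hc : orbitPSp6 l' ⊆ closure (orbitPSp6 l)) :
    ∃ a : Fin 4 → ℕ, l - l' = ∑ i, (a i : ℚ) • simpleRoot i := by
  obtain ⟨m₁, e₁, h₁⟩ := hasOrder_entryInvariant hl
  obtain ⟨m₁', e₁', h₁'⟩ := hasOrder_entryInvariant hl'
  obtain ⟨m₂, e₂, h₂⟩ := hasOrder_bottomMinorInvariant hl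
  obtain ⟨m₂', e₂', h₂'⟩ := hasOrder_bottomMinorInvariant hl'
  obtain ⟨m₃, e₃, h₃⟩ := hasOrder_pairingInvariant hl
  obtain ⟨m₃', e₃', h₃'⟩ := hasOrder_pairingInvariant hl'
  obtain ⟨m₄, e₄, h₄⟩ := hasOrder_cornerMinorInvariant hl
  obtain ⟨m₄', e₄', h₄'⟩ := hasOrder_cornerMinorInvariant hl'
  obtain ⟨m, em, hm⟩ := hasParity_rep hl
  obtain ⟨m', em', hm'⟩ := hasParity_rep hl'
  have hpar := (hm.of_subset_closure hc).unique hm'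
  have i₁ := h₁.le h₁' hc
  have i₂ := h₂.le h₂' hc
  have i₃ := h₃.le h₃' hc
  have i₄ := h₄.le h₄' hc
  obtain ⟨n, hn⟩ := hl.1.1 0
  obtain ⟨n', hn'⟩ := hl'.1.1 0
  -- Here `m - m'` is twice the candidate coefficient of `α₁`; the invariants alone would give only
  -- a half-integer, and `hpar` makes it integral.
  obtain ⟨a₁, ha₁⟩ : ∃ a : ℤ, m - m' = 2 * a := ⟨(m - m') / 2, by omega⟩
  have q₁ : (m : ℚ) - m' = 2 * a₁ := by exact_mod_cast ha₁
  have s₁ : m₁' - m₁ = 2 * a₁ := by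
    have : (m₁' : ℚ) - m₁ = 2 * a₁ := by linarith
    exact_mod_cast this
  -- The first coordinate of `∑ aᵢ αᵢ` is `(a₁ - a₂ + a₃) / 2`; solving for `a₂` shows that it is an
  -- integer.
  have s₂ : m₂' - m₂ = 2 * (a₁ + (m₃' - m₃) - (n - n')) := by
    have : (m₂' : ℚ) - m₂ = 2 * (a₁ + (m₃' - m₃) - (n - n')) := by linarith
    exact_mod_cast this
  obtain ⟨b₁, hb₁⟩ := Int.eq_ofNat_of_zero_le (show 0 ≤ a₁ by omega)
  obtain ⟨b₂, hb₂⟩ := Int.eq_ofNat_of_zero_le (show 0 ≤ a₁ + (m₃' - m₃) - (n - n') by omega)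
  obtain ⟨b₃, hb₃⟩ := Int.eq_ofNat_of_zero_le (show 0 ≤ m₃' - m₃ by omega)
  obtain ⟨b₄, hb₄⟩ := Int.eq_ofNat_of_zero_le (show 0 ≤ m₄' - m₄ by omega)
  have r₁ : (a₁ : ℚ) = b₁ := by exact_mod_cast hb₁
  have r₂ : (a₁ : ℚ) + (m₃' - m₃) - (n - n') = b₂ := by exact_mod_cast hb₂
  have r₃ : (m₃' : ℚ) - m₃ = b₃ := by exact_mod_cast hb₃
  have r₄ : (m₄' : ℚ) - m₄ = b₄ := by exact_mod_cast hb₄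
  refine ⟨![b₁, b₂, b₃, b₄], ?_⟩
  ext i
  fin_cases i <;> simp [Fin.sum_univ_four, simpleRoot] <;> linarith

end GaiottoF4

end

theorem mainTheorem9 (l l' : Fin 4 → ℚ)
    (hl : GaiottoF4.IsRelevant l) (hl' : GaiottoF4.IsRelevant l') :
    (GaiottoF4.orbitPSp6 l' ⊆ closure (GaiottoF4.orbitPSp6 l) ↔
      GaiottoF4.orbitGBar l' ⊆ closure (GaiottoF4.orbitGBar l)) ∧
    (GaiottoF4.orbitPSp6 l' ⊆ closure (GaiottoF4.orbitPSp6 l) →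
      ∃ a : Fin 4 → ℕ, l - l' = ∑ i, (a i : ℚ) • GaiottoF4.simpleRoot i) :=
  ⟨⟨GaiottoF4.orbitGBar_subset_closure_of_orbitPSp6,
    GaiottoF4.orbitPSp6_subset_closure_of_orbitGBar⟩, GaiottoF4.exists_sum_simpleRoot hl hl'⟩
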